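/- **Setting.** Let $I\ge 1$ agents cooperatively solve $$\min_{x\in X} V(x),\qquad V=F+G,\quad F=\sum_{i=1}^I f_i ,$$ where $\emptyset\ne X\subseteq\mathbb R^m$ is closed and convex, $O\supseteq X$ is open, each $f_i:O\to\mathbb R$ is $C^1$ on $O$ with $\nabla f_i$ $L_i$-Lipschitz on $X$ (the $f_i$ may be nonconvex), $G:O\to\mathbb R$ is convex (on every convex subset of $O$; possibly nonsmooth), and $V$ is bounded from below on $X$. *Network.* At time $k=0,1,2,\dots$ the agents communicate over a digraph $\mathcal G^k=(\{1,\dots,I\},E^k)$. For some integer $B>0$ and all $k\ge 0$ the digraph with edge set $\bigcup_{t=k}^{k+B-1}E^t$ is strongly connected. The weight matrices $A^k=(a^k_{ij})$ satisfy, for a constant $\kappa>0$ and all $k$: $a^k_{ij}\ge\kappa$ if $(j,i)\in E^k$; $a^k_{ij}=0$ if $i\neq j$ and $(j,i)\notin E^k$; $a^k_{ii}\ge\kappa$; and $\mathbf 1^TA^k=\mathbf 1^T$. *Surrogates.* The functions $\tilde f_i:O\times O\to\mathbb R$ satisfy, for all $x\in X$, with gradients taken in the first argument: $\tilde f_i(\cdot\,|\,x)$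 is $\tau_i$-strongly convex on $X$ with $\tau_i>0$; $\tilde f_i(\cdot\,|\,x)$ is $C^1$ on $O$ and $\nabla\tilde f_i(x\,|\,x)=\nabla f_i(x)$; and $\nabla\tilde f_i(x\,|\,\cdot)$ is $\tilde L_i$-Lipschitz on $X$. *Algorithm (SONATA).* Start from $x_{(i)}^0\in X$, $\phi_{(i)}^0=1$, $y_{(i)}^0=\nabla f_i(x_{(i)}^0)$. With step sizes $\gamma^k\in(0,1]$ iterate, for $k=0,1,\dots$ and all $i$, $$\tilde x_i^k=\operatorname*{argmin}_{z\in X}\ \tilde f_i(z\,|\,x_{(i)}^k)+\big(I\,y_{(i)}^k-\nabla f_i(x_{(i)}^k)\big)^T(z-x_{(i)}^k)+G(z),\qquad x_{(i)}^{k+1/2}=x_{(i)}^k+\gamma^k(\tilde x_i^k-x_{(i)}^k),$$ $$\phi_{(i)}^{k+1}=\sum_j a_{ij}^k\phi_{(j)}^k,\qquad x_{(i)}^{k+1}=\frac1{\phi_{(i)}^{k+1}}\sum_j a_{ij}^k\phi_{(j)}^kx_{(j)}^{k+1/2},$$ $$y_{(i)}^{k+1}=\frac1{\phi_{(i)}^{k+1}}\sum_j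 a_{ij}^k\phi_{(j)}^ky_{(j)}^k+\frac1{\phi_{(i)}^{k+1}}\big(\nabla f_i(x_{(i)}^{k+1})-\nabla f_i(x_{(i)}^k)\big).$$ *Merit function.* For $x=(x_{(i)})_{i=1}^I$ put $\bar x=\frac1I\sum_i x_{(i)}$, $D(x)=\big(\sum_i\|x_{(i)}-\bar x\|^2\big)^{1/2}$, $$J(\bar x)=\Big\|\bar x-\operatorname*{argmin}_{y\in X}\big\{\nabla F(\bar x)^T(y-\bar x)+\tfrac12\|y-\bar x\|^2+G(y)\big\}\Big\|,\qquad M(x)=\max\{J(\bar x)^2,D(x)^2\}$$ (all norms Euclidean). **Theorem.** There is $\bar\gamma\in(0,1]$, depending only on $I,B,\kappa,(\tau_i),(L_i),(\tilde L_i)$, such that in the setting above, if either (a) (diminishing step size) $\lim_{k\to\infty}\gamma^k=0$ and $\sum_{k=0}^\infty\gamma^k=+\infty$, or (b) (constant step size) $\gamma^k=\gamma$ for all $k$, with $0<\gamma\le\bar\gamma$, then all the minimization problems in the algorithm, and those defining $J(\bar x^k)$, $k\ge0$, have exactly one solution, and $$\lim_{k\to\infty}M(x^k)=0 .$$ In particular,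 $\lim_{k\to\infty}\|x_{(i)}^k-\bar x^k\|=0$ for all $i$, and every limit point $x^\infty$ of $(\bar x^k)_k$ is a d-stationary solution of the problem: $x^\infty\in X$, and for every $y\in X$ the directional derivative $V'(x^\infty;y-x^\infty)$ exists and is $\ge0$. -/

import Mathlib

open Filter Topology
open scoped NNReal

noncomputable section

namespace Sonata

/-- The decision space `ℝ^m` with its Euclidean norm. -/
abbrev Vec (m : ℕ) : Type := EuclideanSpace ℝ (Fin m)

/-- The set of minimizers of `h` over `X`. -/
def minimizers {m : ℕ} (X : Set (Vec m)) (h : Vec m → ℝ) : Set (Vec m) :=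
  {z | z ∈ X ∧ IsMinOn h X z}

/-- `argmin_{z ∈ X} h z`: a point of `minimizers X h` whenever that set is nonempty. -/
def argminOn {m : ℕ} (X : Set (Vec m)) (h : Vec m → ℝ) : Vec m :=
  Classical.epsilon fun z => z ∈ minimizers X h

/-- Data of the networked problem `minimize ∑ i, f i x + G x` over `x ∈ X`. The functions live on
the open set `O ⊇ X`; their values outside `O` play no role. -/
structure Problem (I m : ℕ) where
  X : Set (Vec m)
  O : Set (Vec m)
  f : Fin I → Vec m → ℝ
  G : Vec m → ℝ

namespace Problem

variable {I m : ℕ}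

/-- The smooth part `F = ∑ i, f i`. -/
def F (P : Problem I m) (z : Vec m) : ℝ := ∑ i, P.f i z

/-- The objective `V = F + G`. -/
def V (P : Problem I m) (z : Vec m) : ℝ := P.F z + P.G z

/-- Standing assumptions on the problem, with Lipschitz constants `L i` of the gradients. -/
structure Regular (P : Problem I m) (L : Fin I → ℝ≥0) : Prop where
  nonempty : P.X.Nonempty
  closed : IsClosed P.X
  convex : Convex ℝ P.X
  isOpen : IsOpen P.O
  subset : P.X ⊆ P.O
  smooth : ∀ i, ContDiffOn ℝ 1 (P.f i) P.O
  lipschitz : ∀ i, LipschitzOnWith (L i) (gradient (P.f i)) P.X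
  /-- Convexity of `G` on `O`. Since `O` itself is not required to be convex, this is asked on
  every convex subset of `O`; when `O` is convex it says exactly `ConvexOn ℝ O G`. -/
  convexG : ∀ C ⊆ P.O, Convex ℝ C → ConvexOn ℝ C P.G
  bddBelow : BddBelow (P.V '' P.X)

/-- `z` is a directional-stationary solution: `z ∈ X`, and for every `y ∈ X` the one-sided
directional derivative `V'(z; y - z)` exists and is nonnegative. -/
def IsDStationary (P : Problem I m) (z : Vec m) : Prop :=
  z ∈ P.X ∧ ∀ y ∈ P.X, ∃ v : ℝ, 0 ≤ v ∧
    Tendsto (fun t : ℝ => (P.V (z + t • (y - z)) - P.V z) / t) (𝓝[>] 0) (𝓝 v)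

/-- The function of `y` minimized over `X` in the definition of the stationarity measure at `z`. -/
def proxModel (P : Problem I m) (z y : Vec m) : ℝ :=
  inner ℝ (gradient P.F z) (y - z) + 1 / 2 * ‖y - z‖ ^ 2 + P.G y

/-- The measure of stationarity `J`. -/
def J (P : Problem I m) (z : Vec m) : ℝ := ‖z - argminOn P.X (P.proxModel z)‖

end Problem

variable {I m : ℕ}

/-- Assumptions on the surrogates; `ft i z x` stands for `f̃_i (z | x)`, of which the gradients
are taken with respect to the first argument `z`. -/
structure IsSurrogate (P : Problem I m) (ft : Fin I → Vec m → Vec m → ℝ)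
    (τ : Fin I → ℝ) (Lt : Fin I → ℝ≥0) : Prop where
  strongConvex : ∀ i, ∀ x ∈ P.X, StrongConvexOn P.X (τ i) fun z => ft i z x
  smooth : ∀ i, ∀ x ∈ P.X, ContDiffOn ℝ 1 (fun z => ft i z x) P.O
  consistent : ∀ i, ∀ x ∈ P.X, gradient (fun z => ft i z x) x = gradient (P.f i) x
  lipschitz : ∀ i, ∀ z ∈ P.X, LipschitzOnWith (Lt i) (fun x => gradient (fun w => ft i w x) z) P.X

/-- Strong connectivity: there is a directed path from any node to any other node. -/
def StronglyConnected (E : Fin I → Fin I → Prop) : Prop :=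
  ∀ i j, Relation.ReflTransGen E i j

/-- The union of the edge sets of any `B` consecutive digraphs `Γ k, …, Γ (k + B - 1)` is strongly
connected. -/
def BStronglyConnected (B : ℕ) (Γ : ℕ → Digraph (Fin I)) : Prop :=
  ∀ k, StronglyConnected fun i j => ∃ t, k ≤ t ∧ t < k + B ∧ (Γ t).Adj i j

/-- `A` is compliant with the digraph `Γ` (with lower bound `κ` on its nonzero weights): the weight
`A i j` is attached to the edge from `j` to `i`, and all self-weights are present. -/
structure Compliant (κ : ℝ) (Γ : Digraph (Fin I)) (A : Matrix (Fin I) (Fin I) ℝ) : Prop where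
  eq_zero : ∀ i j, i ≠ j → ¬ Γ.Adj j i → A i j = 0
  edge : ∀ i j, Γ.Adj j i → κ ≤ A i j
  diag : ∀ i, κ ≤ A i i

/-- Column stochasticity `1ᵀ A = 1ᵀ`; nonnegativity of the weights is part of `Compliant`. -/
def ColumnStochastic (A : Matrix (Fin I) (Fin I) ℝ) : Prop := ∀ j, ∑ i, A i j = 1

/-- The variables of all agents at one iteration. -/
structure State (I m : ℕ) where
  x : Fin I → Vec m
  y : Fin I → Vec m
  φ : Fin I → ℝ

/-- The objective of the local subproblem of agent `i`. -/
def localModel (P : Problem I m) (ft : Fin I → Vec m → Vec m → ℝ) (s : State I m) (i : Fin I)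
    (z : Vec m) : ℝ :=
  ft i z (s.x i) + inner ℝ ((I : ℝ) • s.y i - gradient (P.f i) (s.x i)) (z - s.x i) + P.G z

/-- The local SCA step with step size `γ`: the intermediate variable of agent `i`. -/
def half (P : Problem I m) (ft : Fin I → Vec m → Vec m → ℝ) (γ : ℝ) (s : State I m)
    (i : Fin I) : Vec m :=
  s.x i + γ • (argminOn P.X (localModel P ft s i) - s.x i)

/-- The push-sum weights after communication with weight matrix `A`. -/
def nextφ (A : Matrix (Fin I) (Fin I) ℝ) (s : State I m) (i : Fin I) : ℝ :=
  ∑ j, A i j * s.φ j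

/-- The local copies after communication. -/
def nextx (P : Problem I m) (ft : Fin I → Vec m → Vec m → ℝ) (A : Matrix (Fin I) (Fin I) ℝ)
    (γ : ℝ) (s : State I m) (i : Fin I) : Vec m :=
  (1 / nextφ A s i) • ∑ j, (A i j * s.φ j) • half P ft γ s j

/-- The gradient trackers after communication. -/
def nexty (P : Problem I m) (ft : Fin I → Vec m → Vec m → ℝ) (A : Matrix (Fin I) (Fin I) ℝ)
    (γ : ℝ) (s : State I m) (i : Fin I) : Vec m :=
  (1 / nextφ A s i) • ∑ j, (A i j * s.φ j) • s.y j +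
    (1 / nextφ A s i) • (gradient (P.f i) (nextx P ft A γ s i) - gradient (P.f i) (s.x i))

/-- One iteration of SONATA. -/
def step (P : Problem I m) (ft : Fin I → Vec m → Vec m → ℝ) (A : Matrix (Fin I) (Fin I) ℝ)
    (γ : ℝ) (s : State I m) : State I m where
  x := nextx P ft A γ s
  y := nexty P ft A γ s
  φ := nextφ A s

/-- The sequence generated by SONATA from the starting points `x₀`. -/
def run (P : Problem I m) (ft : Fin I → Vec m → Vec m → ℝ) (A : ℕ → Matrix (Fin I) (Fin I) ℝ)
    (γ : ℕ → ℝ) (x₀ : Fin I → Vec m) : ℕ → State I m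
  | 0 => { x := x₀, y := fun i => gradient (P.f i) (x₀ i), φ := fun _ => 1 }
  | k + 1 => step P ft (A k) (γ k) (run P ft A γ x₀ k)

/-- The average of the local copies. -/
def avg (x : Fin I → Vec m) : Vec m := (1 / (I : ℝ)) • ∑ i, x i

/-- The consensus disagreement: the Euclidean norm of the stacked vector `x - 1 ⊗ avg x`. -/
def disagreement (x : Fin I → Vec m) : ℝ := Real.sqrt (∑ i, ‖x i - avg x‖ ^ 2)

/-- The merit function `M`. -/
def merit (P : Problem I m) (x : Fin I → Vec m) : ℝ :=
  max (P.J (avg x) ^ 2) (disagreement x ^ 2)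

/-- The diminishing step-size rule. -/
def Diminishing (γ : ℕ → ℝ) : Prop :=
  Tendsto γ atTop (𝓝 0) ∧ Tendsto (fun n => ∑ k ∈ Finset.range n, γ k) atTop atTop

end Sonata

end

/-! After normalization, push-sum averaging multiplies by a row-stochastic matrix (`pushWeight`)
which carries the φ-weighted average of any family over to the next iteration unchanged. A run is
then governed by three scalars: the size `d` of the search directions and the disagreements `Sx`,
`Sy` of the local copies and of the trackers. Connectivity bounds every product of I·B mixing
matrices below entrywise (`pow_le_transition`), so in an adapted seminorm the disagreements contract
by a factor ρ < 1 at each step, up to inputs of order γd for `Sx` and Sx + γd for `Sy`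
(`exists_consensus_bound`). Since the weighted sum of the trackers is conserved, I·y_i approximates
∇F up to O(Sx + Sy). The local solutions thus give approximate descent directions, and `energy`
drops by c₁γd² up to errors γd(Sx + Sy) and γ²d² (`energy_step_le`).

The rest concerns real sequences (`exists_stepsize_bound`). For small γ, the function U + a·Sx² +
b·Sy² absorbs the errors, so γd² and Sx² + Sy² are summable. As γ may tend to 0, this alone does not
give d → 0. But local solutions depend Lipschitz-continuously on (x, y), so q = d + α·Sx + β·Sy
grows at most by a factor 1 + Mγ per step; together with Σγq² < ∞ and Σγ = ∞ this forces q → 0. Only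
divergence of Σγ and eventual smallness of γ enter, which treats both step-size rules at once.

Finally `J` is controlled by the same three quantities (`J_le`), and the optimality condition of the
proximal problem passes to the limit, giving d-stationarity. -/

namespace Sonata

/-! ### Contraction of disagreement under row-stochastic mixing. -/

section Consensus

variable {ι E : Type*} [Fintype ι] [NormedAddCommGroup E]

/-- The largest distance between two entries of the family `x`. -/
noncomputable def spread (x : ι → E) : ℝ := ‖fun p : ι × ι => x p.1 - x p.2‖

theorem spread_nonneg (x : ι → E) : 0 ≤ spread x := norm_nonneg _

theorem norm_sub_le_spread (x : ι → E) (i j : ι) : ‖x i - x j‖ ≤ spread x :=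
  norm_le_pi_norm (fun p : ι × ι => x p.1 - x p.2) (i, j)

theorem spread_le {x : ι → E} {D : ℝ} (hD : 0 ≤ D) (h : ∀ i j, ‖x i - x j‖ ≤ D) :
    spread x ≤ D :=
  (pi_norm_le_iff_of_nonneg hD).2 fun p => h p.1 p.2

theorem spread_add_le (x u : ι → E) : spread (x + u) ≤ spread x + spread u := by
  refine spread_le (add_nonneg (spread_nonneg _) (spread_nonneg _)) fun i j => ?_
  have : (x + u) i - (x + u) j = (x i - x j) + (u i - u j) := by simp; abel
  rw [this]
  exact (norm_add_le _ _).trans (add_le_add (norm_sub_le_spread x i j) (norm_sub_le_spread u i j))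

theorem spread_le_two_mul_norm (u : ι → E) : spread u ≤ 2 * ‖u‖ := by
  refine spread_le (by positivity) fun i j => (norm_sub_le _ _).trans ?_
  linarith [norm_le_pi_norm u i, norm_le_pi_norm u j]

variable [NormedSpace ℝ E]

theorem norm_sum_smul_le {w : ι → ℝ} (hw : ∀ i, 0 ≤ w i) {z : ι → E} {D : ℝ}
    (hz : ∀ i, ‖z i‖ ≤ D) : ‖∑ i, w i • z i‖ ≤ (∑ i, w i) * D := by
  rw [Finset.sum_mul]
  refine norm_sum_le_of_le _ fun i _ => ?_
  rw [norm_smul, Real.norm_of_nonneg (hw i)]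
  exact mul_le_mul_of_nonneg_left (hz i) (hw i)

theorem norm_sub_sum_smul_le_spread {w : ι → ℝ} (hw : ∀ i, 0 ≤ w i) (h1 : ∑ i, w i = 1)
    (x : ι → E) (i : ι) : ‖x i - ∑ j, w j • x j‖ ≤ spread x := by
  have : x i - ∑ j, w j • x j = ∑ j, w j • (x i - x j) := by
    simp_rw [smul_sub, Finset.sum_sub_distrib, ← Finset.sum_smul, h1, one_smul]
  rw [this]
  simpa [h1] using norm_sum_smul_le hw fun j => norm_sub_le_spread x i j

/-- Product coupling: s times the difference is the double sum of p_i q_j (x_i - x_j), whose total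
mass is s². -/
theorem norm_sum_smul_sub_sum_smul_le {p q : ι → ℝ} (hp : ∀ i, 0 ≤ p i) (hq : ∀ i, 0 ≤ q i)
    {s : ℝ} (hps : ∑ i, p i = s) (hqs : ∑ i, q i = s) (x : ι → E) :
    ‖∑ i, p i • x i - ∑ i, q i • x i‖ ≤ s * spread x := by
  have hs : 0 ≤ s := hps ▸ Finset.sum_nonneg fun i _ => hp i
  rcases hs.eq_or_lt with h0 | hs'
  · have hp0 : ∀ i, p i = 0 := fun i =>
      (Finset.sum_eq_zero_iff_of_nonneg fun i _ => hp i).1 (hps.trans h0.symm) i (Finset.mem_univ i)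
    have hq0 : ∀ i, q i = 0 := fun i =>
      (Finset.sum_eq_zero_iff_of_nonneg fun i _ => hq i).1 (hqs.trans h0.symm) i (Finset.mem_univ i)
    simp [hp0, hq0, ← h0]
  · have key : s • (∑ i, p i • x i - ∑ i, q i • x i) =
        ∑ i, p i • ∑ j, q j • (x i - x j) := by
      simp_rw [smul_sub, Finset.sum_sub_distrib, ← Finset.sum_smul, hqs, smul_sub,
        Finset.sum_sub_distrib, ← Finset.sum_smul, hps, Finset.smul_sum]
      congr 1
      exact Finset.sum_congr rfl fun i _ => smul_comm _ _ _
    have hle : ‖s • (∑ i, p i • x i - ∑ i, q i • x i)‖ ≤ s * (s * spread x) := by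
      rw [key]
      refine (norm_sum_smul_le hp (D := s * spread x) fun i => ?_).trans_eq (by rw [hps])
      exact (norm_sum_smul_le hq fun j => norm_sub_le_spread x i j).trans_eq (by rw [hqs])
    rw [norm_smul, Real.norm_of_nonneg hs] at hle
    exact le_of_mul_le_mul_left hle hs'

/-- The action of a real matrix on families of vectors. -/
noncomputable def mix (W : Matrix ι ι ℝ) (x : ι → E) : ι → E := fun i => ∑ j, W i j • x j

theorem mix_add (W : Matrix ι ι ℝ) (x u : ι → E) : mix W (x + u) = mix W x + mix W u := by
  ext i; simp [mix, smul_add, Finset.sum_add_distrib]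

theorem mix_mul (A W : Matrix ι ι ℝ) (x : ι → E) : mix (A * W) x = mix A (mix W x) := by
  ext i
  simp only [mix, Matrix.mul_apply, Finset.sum_smul, Finset.smul_sum, mul_smul]
  exact Finset.sum_comm

theorem mix_one [DecidableEq ι] (x : ι → E) : mix (1 : Matrix ι ι ℝ) x = x := by
  ext i; simp [mix, Matrix.one_apply, ite_smul]

/-- Row stochasticity. -/
structure RowStochastic (W : Matrix ι ι ℝ) : Prop where
  nonneg : ∀ i j, 0 ≤ W i j
  sum_eq : ∀ i, ∑ j, W i j = 1

theorem RowStochastic.one [DecidableEq ι] : RowStochastic (1 : Matrix ι ι ℝ) where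
  nonneg i j := by rw [Matrix.one_apply]; split_ifs <;> norm_num
  sum_eq i := by simp [Matrix.one_apply]

theorem RowStochastic.mul {A W : Matrix ι ι ℝ} (hA : RowStochastic A) (hW : RowStochastic W) :
    RowStochastic (A * W) where
  nonneg i j := Finset.sum_nonneg fun l _ => mul_nonneg (hA.nonneg i l) (hW.nonneg l j)
  sum_eq i := by
    simp only [Matrix.mul_apply]
    rw [Finset.sum_comm]
    simp [← Finset.mul_sum, hW.sum_eq, hA.sum_eq]

theorem RowStochastic.norm_mix_le {W : Matrix ι ι ℝ} (hW : RowStochastic W) (x : ι → E) :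
    ‖mix W x‖ ≤ ‖x‖ := by
  refine (pi_norm_le_iff_of_nonneg (norm_nonneg _)).2 fun i => ?_
  simpa [hW.sum_eq i, mix] using norm_sum_smul_le (hW.nonneg i) fun j => norm_le_pi_norm x j

/-- Doeblin's argument: removing η from every entry does not affect differences of rows, and leaves
rows of mass 1 - card·η ≤ 1 - η. -/
theorem RowStochastic.spread_mix_le [Nonempty ι] {W : Matrix ι ι ℝ} (hW : RowStochastic W)
    {η : ℝ} (hη : 0 ≤ η) (h : ∀ i j, η ≤ W i j) (x : ι → E) :
    spread (mix W x) ≤ (1 - η) * spread x := by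
  have hcard : (1 : ℝ) ≤ Fintype.card ι := by exact_mod_cast Fintype.card_pos
  have hsum : ∀ i, ∑ j, (W i j - η) = 1 - Fintype.card ι * η := fun i => by
    simp [Finset.sum_sub_distrib, hW.sum_eq i]
  have hle : (1 - Fintype.card ι * η) * spread x ≤ (1 - η) * spread x :=
    mul_le_mul_of_nonneg_right (by nlinarith) (spread_nonneg x)
  have hb : ∀ i j, ‖mix W x i - mix W x j‖ ≤ (1 - Fintype.card ι * η) * spread x := fun i j => by
    have := norm_sum_smul_sub_sum_smul_le (fun l => sub_nonneg.2 (h i l))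
      (fun l => sub_nonneg.2 (h j l)) (hsum i) (hsum j) x
    simpa [mix, sub_smul, Finset.sum_sub_distrib] using this
  obtain ⟨i⟩ := ‹Nonempty ι›
  exact spread_le ((norm_nonneg _).trans ((hb i i).trans hle)) fun i j => (hb i j).trans hle

variable [DecidableEq ι]

/-- The product `W (k + n - 1) * ⋯ * W k`. -/
noncomputable def transition (W : ℕ → Matrix ι ι ℝ) (k : ℕ) : ℕ → Matrix ι ι ℝ
  | 0 => 1
  | n + 1 => W (k + n) * transition W k n

theorem transition_succ' (W : ℕ → Matrix ι ι ℝ) (k n : ℕ) :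
    transition W (k + 1) n * W k = transition W k (n + 1) := by
  induction n with
  | zero => simp [transition]
  | succ n ih =>
    rw [transition, Matrix.mul_assoc, ih, transition]
    congr 2
    omega

theorem RowStochastic.transition {W : ℕ → Matrix ι ι ℝ} (hW : ∀ k, RowStochastic (W k))
    (k n : ℕ) : RowStochastic (transition W k n) := by
  induction n with
  | zero => exact .one
  | succ n ih => exact (hW _).mul ih

/-- A seminorm adapted to the products of `N` consecutive matrices of the sequence `W`. -/
noncomputable def adapted (W : ℕ → Matrix ι ι ℝ) (ρ : ℝ) (N k : ℕ) (x : ι → E) : ℝ :=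
  ∑ n ∈ Finset.range N, ρ⁻¹ ^ n * spread (mix (transition W k n) x)

/-- Contraction only over blocks of N steps becomes contraction at every step for the weighted sum
`adapted` of the spreads of the next N unforced iterates: one step shifts this sum by one index. -/
theorem exists_consensus_bound [Nonempty ι] {W : ℕ → Matrix ι ι ℝ}
    (hW : ∀ k, RowStochastic (W k)) {η ρ : ℝ} {N : ℕ} (hN : 0 < N) (hη : 0 ≤ η)
    (hρ : 0 < ρ) (hρN : 1 - η ≤ ρ ^ N) (h : ∀ k i j, η ≤ transition W k N i j)
    {x u : ℕ → ι → E} (hx : ∀ k, x (k + 1) = mix (W k) (x k) + u k) :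
    ∃ S : ℕ → ℝ, (∀ k, spread (x k) ≤ S k) ∧
      ∀ k, S (k + 1) ≤ ρ * S k + (2 * ∑ n ∈ Finset.range N, ρ⁻¹ ^ n) * ‖u k‖ := by
  have hpow : ∀ n : ℕ, 0 ≤ ρ⁻¹ ^ n := fun n => by positivity
  have hle : ∀ k n (z : ι → E), spread (mix (transition W k n) z) ≤ spread z := fun k n z => by
    simpa using (RowStochastic.transition hW k n).spread_mix_le le_rfl
      ((RowStochastic.transition hW k n).nonneg) z
  refine ⟨fun k => adapted W ρ N k (x k), fun k => ?_, fun k => ?_⟩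
  · have := Finset.single_le_sum (f := fun n => ρ⁻¹ ^ n * spread (mix (transition W k n) (x k)))
      (fun n _ => mul_nonneg (hpow n) (spread_nonneg _)) (Finset.mem_range.2 hN)
    simpa [transition, mix_one, adapted] using this
  · have h1 : adapted W ρ N (k + 1) (u k) ≤ (2 * ∑ n ∈ Finset.range N, ρ⁻¹ ^ n) * ‖u k‖ := by
      rw [adapted, mul_comm 2, mul_assoc, Finset.sum_mul]
      refine Finset.sum_le_sum fun n _ => mul_le_mul_of_nonneg_left ?_ (hpow n)
      exact (hle _ _ _).trans (spread_le_two_mul_norm _)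
    have h2 : adapted W ρ N (k + 1) (mix (W k) (x k)) ≤ ρ * adapted W ρ N k (x k) := by
      have e : ρ⁻¹ * adapted W ρ N (k + 1) (mix (W k) (x k)) =
          ∑ n ∈ Finset.range N, ρ⁻¹ ^ (n + 1) * spread (mix (transition W k (n + 1)) (x k)) := by
        rw [adapted, Finset.mul_sum]
        refine Finset.sum_congr rfl fun n _ => ?_
        rw [← mix_mul, transition_succ', pow_succ]; ring
      have e2 := Finset.sum_range_succ'
        (fun n => ρ⁻¹ ^ n * spread (mix (transition W k n) (x k))) N
      rw [Finset.sum_range_succ] at e2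
      -- The term entering at the end of the shifted sum is dominated by the term n = 0 that leaves
      -- it; this is where ρ^N ≥ 1 - η is used.
      have h3 : ρ⁻¹ ^ N * spread (mix (transition W k N) (x k)) ≤ spread (x k) := by
        have := (RowStochastic.transition hW k N).spread_mix_le hη (h k) (x k)
        rw [inv_pow, inv_mul_le_iff₀ (by positivity)]
        exact this.trans (mul_le_mul_of_nonneg_right hρN (spread_nonneg _))
      have h4 : ρ⁻¹ * adapted W ρ N (k + 1) (mix (W k) (x k)) ≤ adapted W ρ N k (x k) := by
        rw [e]
        simp only [pow_zero, one_mul, transition, mix_one] at e2 ⊢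
        simp only [adapted]
        linarith
      rwa [inv_mul_le_iff₀ hρ] at h4
    have h5 : adapted W ρ N (k + 1) (x (k + 1)) ≤
        adapted W ρ N (k + 1) (mix (W k) (x k)) + adapted W ρ N (k + 1) (u k) := by
      rw [hx, adapted, adapted, adapted, ← Finset.sum_add_distrib]
      refine Finset.sum_le_sum fun n _ => ?_
      rw [mix_add, ← mul_add]
      exact mul_le_mul_of_nonneg_left (spread_add_le _ _) (hpow n)
    linarith

end Consensus

/-! ### Positivity of matrix products over jointly connected digraphs. -/

theorem _root_.Relation.ReflTransGen.exists_exit {α : Type*} {r : α → α → Prop}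
    {R : Set α} {a b : α}
    (h : Relation.ReflTransGen r a b) (ha : a ∈ R) (hb : b ∉ R) :
    ∃ c ∈ R, ∃ d ∉ R, r c d := by
  induction h with
  | refl => exact absurd ha hb
  | @tail c d _ hcd ih =>
    by_cases hc : c ∈ R
    · exact ⟨c, hc, d, hb, hcd⟩
    · exact ih hc

/-- The nodes reached from j with weight at least κ^n never leave the set, thanks to self-weights,
and each window of B steps has an edge exiting the set until it is everything. No stochasticity is
assumed, so the bound serves both the weights `A` and the normalized push-sum weights. -/
theorem BStronglyConnected.pow_le_transition {I B : ℕ} {Γ : ℕ → Digraph (Fin I)}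
    (hΓ : BStronglyConnected B Γ) {κ : ℝ} (hκ : 0 < κ) {W : ℕ → Matrix (Fin I) (Fin I) ℝ}
    (hnn : ∀ k i j, 0 ≤ W k i j) (hdiag : ∀ k i, κ ≤ W k i i)
    (hedge : ∀ k i j, (Γ k).Adj j i → κ ≤ W k i j) (k : ℕ) (i j : Fin I) :
    κ ^ (I * B) ≤ transition W k (I * B) i j := by
  classical
  have hT : ∀ n a b, 0 ≤ transition W k n a b := by
    intro n
    induction n with
    | zero => intro a b; simp only [transition, Matrix.one_apply]; split_ifs <;> norm_num
    | succ n ih =>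
      intro a b
      rw [transition, Matrix.mul_apply]
      exact Finset.sum_nonneg fun l _ => mul_nonneg (hnn _ _ _) (ih _ _)
  let R : ℕ → Finset (Fin I) := fun n => Finset.univ.filter fun a => κ ^ n ≤ transition W k n a j
  have hR : ∀ n a, a ∈ R n ↔ κ ^ n ≤ transition W k n a j := fun n a => by simp [R]
  have hstep : ∀ n a b, a ∈ R n → κ ≤ W (k + n) b a → b ∈ R (n + 1) := fun n a b ha hab => by
    rw [hR] at ha ⊢
    calc κ ^ (n + 1) = κ * κ ^ n := pow_succ' _ _
      _ ≤ W (k + n) b a * transition W k n a j :=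
        mul_le_mul hab ha (by positivity) (hnn _ _ _)
      _ ≤ transition W k (n + 1) b j :=
        Finset.single_le_sum (f := fun l => W (k + n) b l * transition W k n l j)
          (fun l _ => mul_nonneg (hnn _ _ _) (hT _ _ _)) (Finset.mem_univ a)
  have hmono : Monotone R := monotone_nat_of_le_succ fun n a ha => hstep n a a ha (hdiag _ _)
  have hj : ∀ n, j ∈ R n := fun n => hmono (Nat.zero_le n) (by simp [hR, transition])
  have hgrow : ∀ n, n + 1 ≤ (R (n * B)).card ∨ R (n * B) = Finset.univ := by
    intro n
    induction n with
    | zero => exact Or.inl (Finset.card_pos.2 ⟨j, hj _⟩)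
    | succ n ih =>
      have hsub : R (n * B) ⊆ R ((n + 1) * B) := hmono (Nat.mul_le_mul_right _ (Nat.le_succ n))
      by_cases huniv : R (n * B) = Finset.univ
      · exact Or.inr (Finset.eq_univ_of_forall fun a => hsub (huniv ▸ Finset.mem_univ a))
      · have hc := ih.resolve_right huniv
        obtain ⟨i₀, hi₀⟩ : ∃ a, a ∉ R (n * B) := by
          by_contra! hall
          exact huniv (Finset.eq_univ_of_forall hall)
        obtain ⟨a, ha, b, hb, t, ht1, ht2, hadj⟩ :=
          Relation.ReflTransGen.exists_exit (R := (R (n * B) : Set (Fin I))) (hΓ (k + n * B) j i₀)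
            (by simpa using hj _) (by simpa using hi₀)
        obtain ⟨n', rfl⟩ : ∃ n', t = k + n' := ⟨t - k, by omega⟩
        have hB : (n + 1) * B = n * B + B := by ring
        have hb' : b ∈ R ((n + 1) * B) := hmono (by omega : n' + 1 ≤ (n + 1) * B)
          (hstep n' a b (hmono (by omega : n * B ≤ n') ha) (hedge _ _ _ hadj))
        have : (R (n * B)).card < (R ((n + 1) * B)).card :=
          Finset.card_lt_card ⟨hsub, fun hh => hb (hh hb')⟩
        exact Or.inl (by omega)
  -- At n = I the alternative would require I + 1 nodes.
  have : R (I * B) = Finset.univ := (hgrow I).resolve_left fun hle => by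
    have := (R (I * B)).card_le_univ
    simp only [Fintype.card_fin] at this
    omega
  exact (hR _ _).1 (this ▸ Finset.mem_univ i)

/-! ### Scalar recursions and the Lyapunov argument. -/

theorem sq_affine_le {ρ s v : ℝ} (hρ0 : 0 ≤ ρ) (hρ : ρ < 1) :
    (ρ * s + v) ^ 2 ≤ ρ * s ^ 2 + (1 - ρ)⁻¹ * v ^ 2 := by
  have h : 0 < 1 - ρ := by linarith
  have : ρ * s ^ 2 + (1 - ρ)⁻¹ * v ^ 2 - (ρ * s + v) ^ 2 =
      ρ * (1 - ρ)⁻¹ * ((1 - ρ) * s - v) ^ 2 := by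
    field_simp; ring
  have : 0 ≤ ρ * (1 - ρ)⁻¹ * ((1 - ρ) * s - v) ^ 2 := by positivity
  linarith

/-- A bounded-below sequence whose decrements eventually dominate nonnegative terms forces these
terms to be summable. -/
theorem summable_of_eventually_decrease {Φ r : ℕ → ℝ} (hr : ∀ k, 0 ≤ r k) {b : ℝ}
    (hb : ∀ k, b ≤ Φ k) (h : ∀ᶠ k in atTop, Φ (k + 1) ≤ Φ k - r k) : Summable r := by
  obtain ⟨K, hK⟩ := eventually_atTop.1 h
  rw [← summable_nat_add_iff K]
  refine summable_of_sum_range_le (c := Φ K - b) (fun n => hr _) fun n => ?_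
  have : ∑ i ∈ Finset.range n, r (i + K) ≤ Φ K - Φ (n + K) := by
    induction n with
    | zero => simp
    | succ n ih =>
      rw [Finset.sum_range_succ]
      have := hK (n + K) (by omega)
      rw [show n + 1 + K = n + K + 1 by omega]
      linarith
  linarith [hb (n + K)]

/-- If `p` is nonnegative, `γ p` is summable, `γ` is not, and `p` increases by at most a multiple
of `γ p`, then `p` vanishes in the limit. -/
theorem tendsto_zero_of_summable_mul {p γ : ℕ → ℝ} {C : ℝ} (hp : ∀ k, 0 ≤ p k)
    (hγ : ∀ k, 0 ≤ γ k) (hC : 0 ≤ C)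
    (hγsum : Tendsto (fun n => ∑ k ∈ Finset.range n, γ k) atTop atTop)
    (hs : Summable fun k => γ k * p k) (h : ∀ k, p (k + 1) ≤ p k + C * (γ k * p k)) :
    Tendsto p atTop (𝓝 0) := by
  -- Subtracting the accumulated increments makes the sequence monotone, so p converges; only the
  -- value of the limit remains to be found.
  let g : ℕ → ℝ := fun n => p n - C * ∑ k ∈ Finset.range n, γ k * p k
  have hg : Antitone g := antitone_nat_of_succ_le fun n => by
    simp only [g, Finset.sum_range_succ]
    linarith [h n]
  have hsum := hs.hasSum.tendsto_sum_nat
  have hbd : BddBelow (Set.range g) := by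
    refine ⟨-(C * ∑' k, γ k * p k), ?_⟩
    rintro _ ⟨n, rfl⟩
    have := hs.sum_le_tsum (Finset.range n) fun k _ => mul_nonneg (hγ k) (hp k)
    have := mul_le_mul_of_nonneg_left this hC
    simp only [g]
    linarith [hp n]
  have hlim := (tendsto_atTop_ciInf hg hbd).add (hsum.const_mul C)
  simp only [g, sub_add_cancel] at hlim
  set ℓ := (⨅ i, g i) + C * ∑' k, γ k * p k
  have hlim' : Tendsto p atTop (𝓝 ℓ) := hlim
  have hℓ : 0 ≤ ℓ := ge_of_tendsto' hlim' hp
  rcases hℓ.eq_or_lt with h0 | hpos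
  · rwa [← h0] at hlim'
  · exfalso
    obtain ⟨K, hK⟩ := eventually_atTop.1 (hlim'.eventually (lt_mem_nhds (half_lt_self hpos)))
    -- With a limit ℓ > 0, eventually γ ≤ (2/ℓ)·γp, contradicting divergence of the sum.
    have hγs : Summable γ := by
      rw [← summable_nat_add_iff K]
      refine Summable.of_nonneg_of_le (fun n => hγ _) (fun n => ?_)
        (((summable_nat_add_iff K).2 hs).mul_left (2 / ℓ))
      have h1 := hK (n + K) (by omega)
      have h2 := mul_le_mul_of_nonneg_left h1.le (hγ (n + K))
      rw [div_mul_eq_mul_div, le_div_iff₀ hpos]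
      linarith
    exact not_tendsto_nhds_of_tendsto_atTop hγsum _ hγs.hasSum.tendsto_sum_nat

-- A small-gain argument: the contraction of `Sx` and `Sy` and the descent of `U` pay for the
-- coupling terms. The threshold depends only on the constants and ρ, not on the sequences.
set_option maxHeartbeats 1000000 in
theorem exists_stepsize_bound {c₁ c₂ c₃ c₄ c₅ c₆ ρ : ℝ} (h1 : 0 < c₁)
    (h3 : 0 ≤ c₃) (h4 : 0 ≤ c₄) (h5 : 0 ≤ c₅) (h6 : 0 ≤ c₆) (hρ0 : 0 ≤ ρ) (hρ : ρ < 1) :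
    ∃ γbar : ℝ, 0 < γbar ∧ γbar ≤ 1 ∧ ∀ (U d Sx Sy γ : ℕ → ℝ) (b₀ : ℝ),
      (∀ k, b₀ ≤ U k) → (∀ k, 0 ≤ d k) → (∀ k, 0 ≤ Sx k) → (∀ k, 0 ≤ Sy k) →
      (∀ k, 0 ≤ γ k ∧ γ k ≤ 1) → (∀ᶠ k in atTop, γ k ≤ γbar) →
      Tendsto (fun n => ∑ k ∈ Finset.range n, γ k) atTop atTop →
      (∀ k, U (k + 1) ≤ U k - c₁ * γ k * d k ^ 2 + c₂ * γ k * d k * (Sx k + Sy k) +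
        c₃ * γ k ^ 2 * d k ^ 2) →
      (∀ k, Sx (k + 1) ≤ ρ * Sx k + c₄ * (γ k * d k)) →
      (∀ k, Sy (k + 1) ≤ ρ * Sy k + c₅ * (Sx k + γ k * d k)) →
      (∀ k, d (k + 1) ≤ d k + c₆ * (Sx k + Sy k + γ k * d k)) →
      Tendsto d atTop (𝓝 0) ∧ Tendsto Sx atTop (𝓝 0) ∧ Tendsto Sy atTop (𝓝 0) := by
  have hρ' : 0 < 1 - ρ := by linarith
  set e := (1 - ρ)⁻¹ with he
  have he0 : 0 < e := by positivity
  have hee : (1 - ρ) * e = 1 := mul_inv_cancel₀ hρ'.ne'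
  -- D is the Young constant of the cross term. The weights are fixed by (1-ρ)b = D + 1 and (1-ρ)a =
  -- D + 1 + 2bc₅²e: the contraction pays for the cross term and for the influence of `Sx` on `Sy`,
  -- and leaves one unit of each square. K gathers the coefficients of γ²d².
  set D := c₂ ^ 2 / c₁ with hD
  have hD0 : 0 ≤ D := by positivity
  set b := (D + 1) * e with hb
  have hb0 : 0 ≤ b := by positivity
  set a := (D + 1 + 2 * b * c₅ ^ 2 * e) * e with ha
  have ha0 : 0 ≤ a := by positivity
  set K := c₃ + a * c₄ ^ 2 * e + 2 * b * c₅ ^ 2 * e with hK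
  have hK0 : 0 ≤ K := by positivity
  refine ⟨min 1 (c₁ / (4 * (K + 1))), by positivity, min_le_left _ _, ?_⟩
  intro U d Sx Sy γ b₀ hU hd hSx hSy hγ hγbar hγsum H1 H2 H3 H4
  clear_value K a b D e
  have hdec : ∀ᶠ k in atTop, (U (k + 1) + a * Sx (k + 1) ^ 2 + b * Sy (k + 1) ^ 2) ≤
      (U k + a * Sx k ^ 2 + b * Sy k ^ 2) -
        (c₁ / 4 * (γ k * d k ^ 2) + (Sx k ^ 2 + Sy k ^ 2)) := by
    filter_upwards [hγbar] with k hk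
    obtain ⟨hγ0, hγ1⟩ := hγ k
    have hKγ : K * γ k ≤ c₁ / 4 := by
      have := hk.trans (min_le_right _ _)
      rw [le_div_iff₀ (by positivity)] at this
      have := mul_nonneg hK0 hγ0
      linarith
    have q1 : Sx (k + 1) ^ 2 ≤ ρ * Sx k ^ 2 + e * (c₄ * (γ k * d k)) ^ 2 :=
      (pow_le_pow_left₀ (hSx _) (H2 k) 2).trans (he ▸ sq_affine_le hρ0 hρ)
    have q2 : Sy (k + 1) ^ 2 ≤ ρ * Sy k ^ 2 + e * (c₅ * (Sx k + γ k * d k)) ^ 2 :=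
      (pow_le_pow_left₀ (hSy _) (H3 k) 2).trans (he ▸ sq_affine_le hρ0 hρ)
    have q3 : (c₅ * (Sx k + γ k * d k)) ^ 2 ≤ 2 * c₅ ^ 2 * (Sx k ^ 2 + γ k ^ 2 * d k ^ 2) := by
      have := mul_nonneg (sq_nonneg c₅) (sq_nonneg (Sx k - γ k * d k))
      linarith
    -- Young's inequality spends half of the descent c₁γd²; the γ²d² terms spend another quarter, so
    -- a quarter survives.
    have q4 : c₂ * γ k * d k * (Sx k + Sy k) ≤
        c₁ / 2 * (γ k * d k ^ 2) + D * (Sx k ^ 2 + Sy k ^ 2) := by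
      have w1 : c₂ * d k * (Sx k + Sy k) ≤ c₁ / 2 * d k ^ 2 + D / 2 * (Sx k + Sy k) ^ 2 := by
        have : c₁ / 2 * d k ^ 2 + D / 2 * (Sx k + Sy k) ^ 2 - c₂ * d k * (Sx k + Sy k) =
            (c₁ * d k - c₂ * (Sx k + Sy k)) ^ 2 / (2 * c₁) := by
          rw [hD]; field_simp; ring
        have : 0 ≤ (c₁ * d k - c₂ * (Sx k + Sy k)) ^ 2 / (2 * c₁) := by positivity
        linarith
      have w2 : D / 2 * (Sx k + Sy k) ^ 2 ≤ D * (Sx k ^ 2 + Sy k ^ 2) := by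
        have := mul_nonneg hD0 (sq_nonneg (Sx k - Sy k))
        linarith
      have w3 : 0 ≤ D * (Sx k ^ 2 + Sy k ^ 2) := by positivity
      have w4 := mul_le_mul_of_nonneg_left (w1.trans (add_le_add_right w2 _)) hγ0
      have w5 := mul_le_mul_of_nonneg_right hγ1 w3
      linarith
    have q5 := mul_le_mul_of_nonneg_left q1 ha0
    have q6 := mul_le_mul_of_nonneg_left
      (q2.trans (add_le_add_right (mul_le_mul_of_nonneg_left q3 he0.le) _)) hb0
    have q7 : K * (γ k ^ 2 * d k ^ 2) ≤ c₁ / 4 * (γ k * d k ^ 2) := by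
      have := mul_le_mul_of_nonneg_right hKγ (mul_nonneg hγ0 (sq_nonneg (d k)))
      linarith
    have ea : a * ρ = a - (D + 1 + 2 * b * c₅ ^ 2 * e) := by
      have : a * (1 - ρ) = D + 1 + 2 * b * c₅ ^ 2 * e := by
        rw [ha, mul_assoc, mul_comm e, hee, mul_one]
      linarith
    have eb : b * ρ = b - (D + 1) := by
      have : b * (1 - ρ) = D + 1 := by rw [hb, mul_assoc, mul_comm e, hee, mul_one]
      linarith
    have q5' : a * Sx (k + 1) ^ 2 ≤ (a - (D + 1 + 2 * b * c₅ ^ 2 * e)) * Sx k ^ 2 +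
        a * c₄ ^ 2 * e * (γ k ^ 2 * d k ^ 2) := by rw [← ea]; linarith
    have q6' : b * Sy (k + 1) ^ 2 ≤ (b - (D + 1)) * Sy k ^ 2 +
        2 * b * c₅ ^ 2 * e * (Sx k ^ 2 + γ k ^ 2 * d k ^ 2) := by rw [← eb]; linarith
    have q7' : c₃ * (γ k ^ 2 * d k ^ 2) + a * c₄ ^ 2 * e * (γ k ^ 2 * d k ^ 2) +
        2 * b * c₅ ^ 2 * e * (γ k ^ 2 * d k ^ 2) ≤ c₁ / 4 * (γ k * d k ^ 2) := by
      rw [← add_mul, ← add_mul, ← hK]; exact q7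
    linarith [H1 k]
  have hsum := summable_of_eventually_decrease
    (Φ := fun k => U k + a * Sx k ^ 2 + b * Sy k ^ 2)
    (r := fun k => c₁ / 4 * (γ k * d k ^ 2) + (Sx k ^ 2 + Sy k ^ 2)) (fun k => by
    have := (hγ k).1; positivity) (b := b₀) (fun k => by
    have : 0 ≤ a * Sx k ^ 2 + b * Sy k ^ 2 := by positivity
    linarith [hU k]) hdec
  have hS2 : Summable fun k => Sx k ^ 2 + Sy k ^ 2 :=
    Summable.of_nonneg_of_le (fun k => by positivity) (fun k => by
      have : 0 ≤ c₁ / 4 * (γ k * d k ^ 2) := by have := (hγ k).1; positivity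
      linarith) hsum
  have hd2 : Summable fun k => γ k * d k ^ 2 :=
    Summable.of_nonneg_of_le (fun k => by have := (hγ k).1; positivity) (fun k => by
      have : 0 ≤ Sx k ^ 2 + Sy k ^ 2 := by positivity
      calc γ k * d k ^ 2 = 4 / c₁ * (c₁ / 4 * (γ k * d k ^ 2)) := by field_simp
        _ ≤ _ := mul_le_mul_of_nonneg_left (le_add_of_nonneg_right this) (by positivity))
      (hsum.mul_left (4 / c₁))
  -- α and β are large enough that the contraction of `Sx` and `Sy` compensates their contribution
  -- to the growth of d; only the M·γ·d term is left.
  set β := c₆ * e + 1 with hβ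
  have hβ0 : 0 < β := by positivity
  set α := (c₆ + β * c₅) * e + 1 with hα
  have hα0 : 0 < α := by positivity
  have hβρ : c₆ + β * ρ ≤ β := by
    have : β * (1 - ρ) = c₆ + (1 - ρ) := by rw [hβ, add_mul, mul_assoc, mul_comm e, hee]; ring
    linarith
  have hαρ : c₆ + β * c₅ + α * ρ ≤ α := by
    have : α * (1 - ρ) = c₆ + β * c₅ + (1 - ρ) := by
      rw [hα, add_mul, mul_assoc, mul_comm e, hee]; ring
    linarith
  set q : ℕ → ℝ := fun k => d k + α * Sx k + β * Sy k with hq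
  have hq0 : ∀ k, 0 ≤ q k := fun k => by
    have := hd k; have := hSx k; have := hSy k; positivity
  set M := c₆ + α * c₄ + β * c₅ with hM
  have hM0 : 0 ≤ M := by positivity
  have hqstep : ∀ k, q (k + 1) ≤ (1 + M * γ k) * q k := fun k => by
    have i1 := mul_le_mul_of_nonneg_left (H2 k) hα0.le
    have i2 := mul_le_mul_of_nonneg_left (H3 k) hβ0.le
    have i3 := mul_le_mul_of_nonneg_right hβρ (hSy k)
    have i4 := mul_le_mul_of_nonneg_right hαρ (hSx k)
    have i5 : d k ≤ q k := by
      have := mul_nonneg hα0.le (hSx k); have := mul_nonneg hβ0.le (hSy k)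
      simp only [hq]; linarith
    have i6 := mul_le_mul_of_nonneg_left i5 (mul_nonneg hM0 (hγ k).1)
    have i7 : q (k + 1) ≤ q k + M * γ k * d k := by
      simp only [hq, hM]; linarith [H4 k]
    linarith
  have hp : Tendsto (fun k => q k ^ 2) atTop (𝓝 0) := by
    refine tendsto_zero_of_summable_mul (C := 2 * M + M ^ 2) (fun k => sq_nonneg _)
      (fun k => (hγ k).1) (by positivity) hγsum ?_ fun k => ?_
    · refine Summable.of_nonneg_of_le (fun k => mul_nonneg (hγ k).1 (sq_nonneg _)) (fun k => ?_)
        ((hd2.add (hS2.mul_left (α ^ 2 + β ^ 2))).mul_left 3)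
      have j1 : q k ^ 2 ≤ 3 * (d k ^ 2 + (α ^ 2 + β ^ 2) * (Sx k ^ 2 + Sy k ^ 2)) := by
        have j5 := sq_nonneg (d k - α * Sx k)
        have j6 := sq_nonneg (d k - β * Sy k)
        have j7 := sq_nonneg (α * Sx k - β * Sy k)
        have j8 := sq_nonneg (α * Sy k)
        have j9 := sq_nonneg (β * Sx k)
        simp only [hq]
        linarith
      have j2 := mul_le_mul_of_nonneg_left j1 (hγ k).1
      have j3 : 0 ≤ (α ^ 2 + β ^ 2) * (Sx k ^ 2 + Sy k ^ 2) := by positivity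
      have j4 := mul_le_mul_of_nonneg_right (hγ k).2 j3
      linarith
    · have k1 := pow_le_pow_left₀ (hq0 _) (hqstep k) 2
      have k2 : γ k ^ 2 ≤ γ k := pow_le_of_le_one (hγ k).1 (hγ k).2 two_ne_zero
      have k3 := mul_le_mul_of_nonneg_left k2 (mul_nonneg (sq_nonneg M) (sq_nonneg (q k)))
      have k4 : ((1 + M * γ k) * q k) ^ 2 =
        q k ^ 2 + 2 * M * (γ k * q k ^ 2) + M ^ 2 * q k ^ 2 * γ k ^ 2 := by ring
      rw [k4] at k1
      linarith
  have hqlim : Tendsto q atTop (𝓝 0) := by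
    have := hp.sqrt
    simpa [Real.sqrt_sq (hq0 _)] using this
  refine ⟨squeeze_zero hd (fun k => ?_) hqlim, squeeze_zero hSx (g := fun k => α⁻¹ * q k)
    (fun k => ?_) (by simpa using hqlim.const_mul α⁻¹), squeeze_zero hSy (g := fun k => β⁻¹ * q k)
    (fun k => ?_) (by simpa using hqlim.const_mul β⁻¹)⟩
  all_goals
    have n1 := hd k
    have n2 := mul_nonneg hα0.le (hSx k)
    have n3 := mul_nonneg hβ0.le (hSy k)
  · simp only [hq]; linarith
  · rw [le_inv_mul_iff₀ hα0]; simp only [hq]; linarith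
  · rw [le_inv_mul_iff₀ hβ0]; simp only [hq]; linarith

/-! ### Convex analysis: minimizers, optimality conditions, descent. -/

section Convex

variable {E : Type*} [NormedAddCommGroup E] [InnerProductSpace ℝ E]

theorem add_smul_sub_mem {X : Set E} (hX : Convex ℝ X) {x y : E} (hx : x ∈ X) (hy : y ∈ X)
    {t : ℝ} (h0 : 0 ≤ t) (h1 : t ≤ 1) : x + t • (y - x) ∈ X :=
  hX.add_smul_sub_mem hx hy ⟨h0, h1⟩

theorem _root_.ConvexOn.map_add_smul_sub_le {X : Set E} {G : E → ℝ} (hG : ConvexOn ℝ X G)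
    {x y : E} (hx : x ∈ X) (hy : y ∈ X) {t : ℝ} (h0 : 0 ≤ t) (h1 : t ≤ 1) :
    G (x + t • (y - x)) ≤ G x + t * (G y - G x) := by
  have := hG.2 hx hy (sub_nonneg.2 h1) h0 (by ring)
  rw [show x + t • (y - x) = (1 - t) • x + t • y by module]
  simp only [smul_eq_mul] at this
  linarith

theorem _root_.StrongConvexOn.add_convexOn {X : Set E} {τ : ℝ} {g G : E → ℝ}
    (hg : StrongConvexOn X τ g) (hG : ConvexOn ℝ X G) :
    StrongConvexOn X τ fun z => g z + G z := by
  refine ⟨hG.1, fun x hx y hy a b ha hb hab => ?_⟩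
  have h1 := hg.2 hx hy ha hb hab
  have h2 := hG.2 hx hy ha hb hab
  simp only [smul_eq_mul] at h1 h2 ⊢
  linarith

theorem convexOn_inner_sub {X : Set E} (hX : Convex ℝ X) (c x : E) :
    ConvexOn ℝ X fun z => inner ℝ c (z - x) := by
  refine ⟨hX, fun y _ z _ a b _ _ hab => le_of_eq ?_⟩
  have : a • y + b • z - x = a • (y - x) + b • (z - x) := by
    obtain rfl : a = 1 - b := by linarith
    module
  simp only [this, inner_add_right, inner_smul_right, smul_eq_mul]

theorem strongConvexOn_half_norm_sub_sq {X : Set E} (hX : Convex ℝ X) (x : E) :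
    StrongConvexOn X 1 fun z => 1 / 2 * ‖z - x‖ ^ 2 := by
  refine ⟨hX, fun y _ z _ a b _ _ hab => le_of_eq ?_⟩
  have e1 : a • y + b • z - x = a • (y - x) + b • (z - x) := by
    obtain rfl : a = 1 - b := by linarith
    module
  have e2 : y - z = (y - x) - (z - x) := by abel
  simp only [e1, e2, norm_sub_sq_real (y - x) (z - x), norm_add_sq_real, norm_smul, inner_smul_left,
    inner_smul_right, smul_eq_mul, mul_pow, Real.norm_eq_abs, sq_abs, conj_trivial]
  obtain rfl : a = 1 - b := by linarith
  ring

theorem pos_and_le_one_eventually : ∀ᶠ t : ℝ in 𝓝[>] 0, 0 < t ∧ t ≤ 1 := by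
  filter_upwards [Ioc_mem_nhdsGT (zero_lt_one' ℝ)] with t ht using ht

/-- Strong convexity supplies coercivity: the minimum over the unit ball around x₀ controls h along
rays, and beyond radius R the quadratic gain forces h ≥ h x₀. A minimizer over the ball of radius R
is therefore global. -/
theorem _root_.StrongConvexOn.existsUnique_isMinOn [FiniteDimensional ℝ E] {X : Set E}
    (hX : IsClosed X) (hne : X.Nonempty) {τ : ℝ} (hτ : 0 < τ) {h : E → ℝ}
    (hh : StrongConvexOn X τ h) (hc : ContinuousOn h X) : ∃! z, z ∈ X ∧ IsMinOn h X z := by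
  obtain ⟨x₀, hx₀⟩ := hne
  have : ProperSpace E := FiniteDimensional.proper_real E
  have hcomp : ∀ r : ℝ, IsCompact (X ∩ Metric.closedBall x₀ r) := fun r =>
    (isCompact_closedBall x₀ r).inter_left hX
  have hmem : ∀ r : ℝ, 0 ≤ r → x₀ ∈ X ∩ Metric.closedBall x₀ r := fun r hr =>
    ⟨hx₀, Metric.mem_closedBall_self hr⟩
  obtain ⟨w, hw, hwmin⟩ := (hcomp 1).exists_isMinOn ⟨x₀, hmem 1 zero_le_one⟩
    (hc.mono Set.inter_subset_left)
  have hw0 : h w ≤ h x₀ := hwmin (hmem 1 zero_le_one)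
  set R := 1 + 2 / τ * (h x₀ - h w) with hR
  have hR1 : 1 ≤ R := by
    have : 0 ≤ 2 / τ * (h x₀ - h w) := mul_nonneg (by positivity) (by linarith)
    linarith
  obtain ⟨z, hz, hzmin⟩ := (hcomp R).exists_isMinOn ⟨x₀, hmem R (by linarith)⟩
    (hc.mono Set.inter_subset_left)
  have hz0 : h z ≤ h x₀ := hzmin (hmem R (by linarith))
  suffices hmin : IsMinOn h X z from
    ⟨z, ⟨hz.1, hmin⟩, fun y hy => (hh.strictConvexOn hτ).eq_of_isMinOn hy.2 hmin hy.1 hz.1⟩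
  intro y hy
  by_cases hyR : ‖y - x₀‖ ≤ R
  · exact hzmin ⟨hy, by rwa [Metric.mem_closedBall, dist_eq_norm]⟩
  · push Not at hyR
    set r := ‖y - x₀‖ with hr
    have hr1 : 1 < r := by linarith
    have hr0 : 0 < r := by linarith
    have hrn : r⁻¹ ≤ 1 := inv_le_one_of_one_le₀ hr1.le
    have hp : (1 - r⁻¹) • x₀ + r⁻¹ • y ∈ X ∩ Metric.closedBall x₀ 1 := by
      refine ⟨hh.1 hx₀ hy (sub_nonneg.2 hrn) (by positivity) (by ring), ?_⟩
      rw [Metric.mem_closedBall, dist_eq_norm,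
        show (1 - r⁻¹) • x₀ + r⁻¹ • y - x₀ = r⁻¹ • (y - x₀) by module, norm_smul, norm_inv,
        Real.norm_of_nonneg hr0.le, ← hr, inv_mul_cancel₀ hr0.ne']
    have h1 : h w ≤ h ((1 - r⁻¹) • x₀ + r⁻¹ • y) := hwmin hp
    have h2 := hh.2 hx₀ hy (sub_nonneg.2 hrn) (by positivity : 0 ≤ r⁻¹) (by ring)
    simp only [smul_eq_mul] at h2
    rw [norm_sub_rev, ← hr] at h2
    have h3 := mul_le_mul_of_nonneg_left (h1.trans h2) hr0.le
    have h4 : r * ((1 - r⁻¹) * h x₀ + r⁻¹ * h y - (1 - r⁻¹) * r⁻¹ * (τ / 2 * r ^ 2)) =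
        (r - 1) * h x₀ + h y - (r - 1) * (τ / 2 * r) := by field_simp
    rw [h4] at h3
    show h z ≤ h y
    by_contra! hcon
    have : h x₀ - h w ≤ τ / 2 * (r - 1) := by
      have : τ / 2 * R = τ / 2 + (h x₀ - h w) := by rw [hR]; field_simp
      have := mul_lt_mul_of_pos_left hyR (half_pos hτ)
      linarith
    have := mul_le_mul_of_nonneg_left this hr0.le
    linarith

variable [CompleteSpace E]

theorem _root_.HasGradientAt.tendsto_slope {g : E → ℝ} {v x : E} (hg : HasGradientAt g v x)
    (w : E) : Tendsto (fun t : ℝ => (g (x + t • w) - g x) / t) (𝓝[>] 0) (𝓝 (inner ℝ v w)) := by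
  have := (hg.hasFDerivAt.hasLineDerivAt w).tendsto_slope_zero_right
  simpa [div_eq_inv_mul] using this

/-- First-order optimality for the sum of a differentiable and a convex function. -/
theorem inner_add_sub_nonneg_of_isMinOn {X : Set E} {g G : E → ℝ} (hG : ConvexOn ℝ X G) {v x : E}
    (hx : x ∈ X) (hmin : ∀ z ∈ X, g x + G x ≤ g z + G z) (hg : HasGradientAt g v x) {z : E}
    (hz : z ∈ X) : 0 ≤ inner ℝ v (z - x) + (G z - G x) := by
  refine ge_of_tendsto ((hg.tendsto_slope (z - x)).add_const (G z - G x)) ?_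
  filter_upwards [pos_and_le_one_eventually] with t ⟨h0, h1⟩
  have a1 := hmin _ (add_smul_sub_mem hG.1 hx hz h0.le h1)
  have a2 := hG.map_add_smul_sub_le hx hz h0.le h1
  rw [div_add' _ _ _ h0.ne']
  exact div_nonneg (by linarith) h0.le

/-- Divide the strong convexity inequality at x + t(y - x) by t and let t → 0⁺. -/
theorem _root_.StrongConvexOn.inner_add_le {X : Set E} {τ : ℝ} {g : E → ℝ}
    (hg : StrongConvexOn X τ g) {v x y : E} (hx : x ∈ X) (hy : y ∈ X) (hv : HasGradientAt g v x) :
    inner ℝ v (y - x) + τ / 2 * ‖x - y‖ ^ 2 ≤ g y - g x := by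
  have h1 : Tendsto (fun t : ℝ => (g (x + t • (y - x)) - g x) / t +
      (1 - t) * (τ / 2 * ‖x - y‖ ^ 2)) (𝓝[>] 0)
      (𝓝 (inner ℝ v (y - x) + (1 - 0) * (τ / 2 * ‖x - y‖ ^ 2))) := by
    refine (hv.tendsto_slope (y - x)).add (Tendsto.mul_const _ (tendsto_const_nhds.sub ?_))
    exact tendsto_nhdsWithin_of_tendsto_nhds tendsto_id
  rw [sub_zero, one_mul] at h1
  refine le_of_tendsto h1 ?_
  filter_upwards [pos_and_le_one_eventually] with t ⟨h0, ht1⟩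
  have := hg.2 hx hy (sub_nonneg.2 ht1) h0.le (by ring)
  rw [show (1 - t) • x + t • y = x + t • (y - x) by module] at this
  simp only [smul_eq_mul] at this
  rw [div_add' _ _ _ h0.ne', div_le_iff₀ h0]
  linarith

theorem _root_.StrongConvexOn.le_inner_sub {X : Set E} {τ : ℝ} {g : E → ℝ}
    (hg : StrongConvexOn X τ g) {v w x y : E} (hx : x ∈ X) (hy : y ∈ X) (hv : HasGradientAt g v x)
    (hw : HasGradientAt g w y) : τ * ‖x - y‖ ^ 2 ≤ inner ℝ (v - w) (x - y) := by
  have h1 := hg.inner_add_le hx hy hv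
  have h2 := hg.inner_add_le hy hx hw
  rw [← neg_sub x y, inner_neg_right, norm_neg] at *
  rw [inner_sub_left]
  linarith

/-- The descent lemma via the mean value theorem, with constant L instead of the sharp L/2, which is
harmless here. -/
theorem sub_le_inner_add_of_lipschitzOnWith {X : Set E} (hX : Convex ℝ X) {g : E → ℝ} {v : E → E}
    {L : ℝ≥0} (hv : ∀ x ∈ X, HasGradientAt g (v x) x) (hL : LipschitzOnWith L v X) {x y : E}
    (hx : x ∈ X) (hy : y ∈ X) : g y - g x ≤ inner ℝ (v x) (y - x) + L * ‖y - x‖ ^ 2 := by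
  obtain ⟨z, hz, hzeq⟩ := domain_mvt (fun w hw => (hv w hw).hasFDerivAt.hasFDerivWithinAt) hX hx hy
  have hzX := hX.segment_subset hx hy hz
  have h1 : ‖v z - v x‖ ≤ L * ‖y - x‖ := by
    refine (hL.norm_sub_le hzX hx).trans (mul_le_mul_of_nonneg_left ?_ L.2)
    obtain ⟨t, ⟨h0, h1⟩, rfl⟩ := (segment_eq_image' ℝ x y) ▸ hz
    simp only [add_sub_cancel_left, norm_smul, Real.norm_of_nonneg h0]
    exact mul_le_of_le_one_left (norm_nonneg _) h1
  have h2 : inner ℝ (v z - v x) (y - x) ≤ L * ‖y - x‖ ^ 2 :=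
    (real_inner_le_norm _ _).trans
      ((mul_le_mul_of_nonneg_right h1 (norm_nonneg _)).trans_eq (by ring))
  rw [inner_sub_left] at h2
  simp only [InnerProductSpace.toDual_apply_apply] at hzeq
  linarith

end Convex

section ConvexOpen

variable {E : Type*} [NormedAddCommGroup E] [NormedSpace ℝ E]

theorem continuousOn_of_convexOn_subsets [FiniteDimensional ℝ E] {O : Set E} (hO : IsOpen O)
    {G : E → ℝ} (hG : ∀ C ⊆ O, Convex ℝ C → ConvexOn ℝ C G) : ContinuousOn G O := by
  intro z hz
  obtain ⟨ε, hε, hball⟩ := Metric.isOpen_iff.1 hO z hz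
  exact (((hG _ hball (convex_ball z ε)).continuousOn Metric.isOpen_ball).continuousAt
    (Metric.ball_mem_nhds z hε)).continuousWithinAt

/-- Restricting to a line inside a small ball reduces this to the right derivative of a convex
function of one variable; the ball is needed since O itself may fail to be convex. -/
theorem exists_tendsto_slope_of_convexOn_subsets {O : Set E} (hO : IsOpen O)
    {G : E → ℝ} (hG : ∀ C ⊆ O, Convex ℝ C → ConvexOn ℝ C G) {z : E} (hz : z ∈ O) (w : E) :
    ∃ v : ℝ, Tendsto (fun t : ℝ => (G (z + t • w) - G z) / t) (𝓝[>] 0) (𝓝 v) := by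
  obtain ⟨ε, hε, hball⟩ := Metric.isOpen_iff.1 hO z hz
  let ℓ : ℝ →ᵃ[ℝ] E := AffineMap.lineMap z (z + w)
  have hℓ : ∀ t : ℝ, ℓ t = z + t • w := fun t => by
    simp [ℓ, AffineMap.lineMap_apply, add_comm]
  have hconv := (hG _ hball (convex_ball z ε)).comp_affineMap ℓ
  have hcont : Continuous ℓ := by
    rw [show (ℓ : ℝ → E) = fun t => z + t • w from funext hℓ]
    fun_prop
  have h0 : (0 : ℝ) ∈ interior (ℓ ⁻¹' Metric.ball z ε) := by
    rw [(Metric.isOpen_ball.preimage hcont).interior_eq]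
    simpa [hℓ] using hε
  have := hconv.hasDerivWithinAt_rightDeriv_of_mem_interior h0
  rw [hasDerivWithinAt_iff_tendsto_slope' Set.self_notMem_Ioi] at this
  refine ⟨_, this.congr fun t => ?_⟩
  simp [slope_def_field, hℓ]

end ConvexOpen

/-! ### The proximal and local subproblems. -/

variable {I m : ℕ}

theorem argminOn_mem {X : Set (Vec m)} {h : Vec m → ℝ} (hex : ∃! z, z ∈ minimizers X h) :
    argminOn X h ∈ minimizers X h :=
  Classical.epsilon_spec hex.exists

/-- Each optimality condition is tested at the other solution; adding them cancels the nonsmooth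
term. -/
theorem inner_sub_nonneg_of_optimality {E : Type*} [NormedAddCommGroup E] [InnerProductSpace ℝ E]
    {G : E → ℝ} {p p' q q' : E} (h : 0 ≤ inner ℝ p (q' - q) + (G q' - G q))
    (h' : 0 ≤ inner ℝ p' (q - q') + (G q - G q')) : 0 ≤ inner ℝ (p - p') (q' - q) := by
  rw [← neg_sub q' q, inner_neg_right] at h'
  rw [inner_sub_left]
  linarith

theorem norm_le_of_inner_nonneg {E : Type*} [NormedAddCommGroup E] [InnerProductSpace ℝ E]
    {a b : E} {τ : ℝ} (h : τ * ‖b‖ ^ 2 ≤ inner ℝ a b) : τ * ‖b‖ ≤ ‖a‖ := by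
  rcases (norm_nonneg b).eq_or_lt with h0 | hpos
  · rw [← h0, mul_zero]; exact norm_nonneg a
  · refine le_of_mul_le_mul_right ?_ hpos
    linarith [real_inner_le_norm a b]

namespace Problem.Regular

variable {P : Problem I m} {L : Fin I → ℝ≥0}

theorem convexOn_G (hP : P.Regular L) : ConvexOn ℝ P.X P.G := hP.convexG _ hP.subset hP.convex

theorem continuousOn_G (hP : P.Regular L) : ContinuousOn P.G P.X :=
  (continuousOn_of_convexOn_subsets hP.isOpen hP.convexG).mono hP.subset

theorem hasGradientAt_of_contDiffOn (hP : P.Regular L) {g : Vec m → ℝ} (hg : ContDiffOn ℝ 1 g P.O)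
    {x : Vec m} (hx : x ∈ P.X) : HasGradientAt g (gradient g x) x :=
  ((hg.contDiffAt (hP.isOpen.mem_nhds (hP.subset hx))).differentiableAt one_ne_zero).hasGradientAt

theorem hasGradientAt_f (hP : P.Regular L) (i : Fin I) {x : Vec m} (hx : x ∈ P.X) :
    HasGradientAt (P.f i) (gradient (P.f i) x) x :=
  hP.hasGradientAt_of_contDiffOn (hP.smooth i) hx

theorem hasGradientAt_F (hP : P.Regular L) {x : Vec m} (hx : x ∈ P.X) :
    HasGradientAt P.F (∑ i, gradient (P.f i) x) x := by
  rw [hasGradientAt_iff_hasFDerivAt, map_sum]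
  exact HasFDerivAt.fun_sum fun i _ => (hP.hasGradientAt_f i hx).hasFDerivAt

theorem gradient_F (hP : P.Regular L) {x : Vec m} (hx : x ∈ P.X) :
    gradient P.F x = ∑ i, gradient (P.f i) x :=
  (hP.hasGradientAt_F hx).gradient

theorem norm_sum_gradient_sub_le (hP : P.Regular L) {x : Fin I → Vec m} {z : Vec m} {D : ℝ}
    (hx : ∀ i, x i ∈ P.X) (hz : z ∈ P.X) (hD : ∀ i, ‖x i - z‖ ≤ D) :
    ‖∑ i, gradient (P.f i) (x i) - gradient P.F z‖ ≤ (∑ i, (L i : ℝ)) * D := by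
  rw [hP.gradient_F hz, ← Finset.sum_sub_distrib, Finset.sum_mul]
  exact norm_sum_le_of_le _ fun i _ => ((hP.lipschitz i).norm_sub_le (hx i) hz).trans
    (mul_le_mul_of_nonneg_left (hD i) (L i).2)

theorem lipschitzOnWith_gradient_F (hP : P.Regular L) :
    LipschitzOnWith (∑ i, L i) (gradient P.F) P.X := by
  refine LipschitzOnWith.of_dist_le_mul fun x hx y hy => ?_
  rw [dist_eq_norm, dist_eq_norm, hP.gradient_F hx, NNReal.coe_sum]
  exact hP.norm_sum_gradient_sub_le (x := fun _ => x) (fun _ => hx) hy fun _ => le_rfl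

theorem existsUnique_proxModel (hP : P.Regular L) (z : Vec m) :
    ∃! y, y ∈ minimizers P.X (P.proxModel z) := by
  refine StrongConvexOn.existsUnique_isMinOn hP.closed hP.nonempty one_pos ?_ ?_
  · have := (strongConvexOn_half_norm_sub_sq hP.convex z).add_convexOn
      ((convexOn_inner_sub hP.convex (gradient P.F z) z).add hP.convexOn_G)
    convert this using 2 with y
    simp only [proxModel, Pi.add_apply]
    ring
  · exact ContinuousOn.add (by fun_prop) hP.continuousOn_G

theorem proxModel_optimality (hP : P.Regular L) (z : Vec m) {y : Vec m} (hy : y ∈ P.X) :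
    0 ≤ inner ℝ (gradient P.F z + (argminOn P.X (P.proxModel z) - z))
      (y - argminOn P.X (P.proxModel z)) + (P.G y - P.G (argminOn P.X (P.proxModel z))) := by
  obtain ⟨hmem, hmin⟩ := argminOn_mem (hP.existsUnique_proxModel z)
  refine inner_add_sub_nonneg_of_isMinOn hP.convexOn_G hmem
    (g := fun y => inner ℝ (gradient P.F z) (y - z) + 1 / 2 * ‖y - z‖ ^ 2) (fun w hw => hmin hw)
    ?_ hy
  set x := argminOn P.X (P.proxModel z)
  rw [hasGradientAt_iff_hasFDerivAt]
  have h1 : HasFDerivAt (fun y : Vec m => y - z) (ContinuousLinearMap.id ℝ (Vec m)) x :=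
    (hasFDerivAt_id x).sub_const z
  have h2 := ((hasFDerivAt_const (gradient P.F z) x).inner ℝ h1).add
    (h1.norm_sq.const_mul (1 / 2))
  refine h2.congr_fderiv ?_
  ext w
  simp

end Problem.Regular

section Local

variable {P : Problem I m} {L : Fin I → ℝ≥0} {ft : Fin I → Vec m → Vec m → ℝ} {τ : Fin I → ℝ}
  {Lt : Fin I → ℝ≥0}

/-- The solution of the local subproblem of agent `i`. -/
noncomputable def localSol (P : Problem I m) (ft : Fin I → Vec m → Vec m → ℝ) (s : State I m)
    (i : Fin I) : Vec m :=
  argminOn P.X (localModel P ft s i)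

theorem IsSurrogate.existsUnique_localModel (hS : IsSurrogate P ft τ Lt) (hP : P.Regular L)
    {i : Fin I} (hτ : 0 < τ i) {s : State I m} (hx : s.x i ∈ P.X) :
    ∃! z, z ∈ minimizers P.X (localModel P ft s i) := by
  refine StrongConvexOn.existsUnique_isMinOn hP.closed hP.nonempty hτ ?_ ?_
  · have := (hS.strongConvex i _ hx).add_convexOn
      ((convexOn_inner_sub hP.convex ((I : ℝ) • s.y i - gradient (P.f i) (s.x i)) (s.x i)).add
        hP.convexOn_G)
    convert this using 2 with y
    simp only [localModel, Pi.add_apply]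
    ring
  · exact (((hS.smooth i _ hx).continuousOn.mono hP.subset).add (by fun_prop)).add
      hP.continuousOn_G

theorem IsSurrogate.localSol_mem (hS : IsSurrogate P ft τ Lt) (hP : P.Regular L)
    {i : Fin I} (hτ : 0 < τ i) {s : State I m} (hx : s.x i ∈ P.X) : localSol P ft s i ∈ P.X :=
  (argminOn_mem (hS.existsUnique_localModel hP hτ hx)).1

theorem IsSurrogate.localSol_optimality (hS : IsSurrogate P ft τ Lt) (hP : P.Regular L)
    {i : Fin I} (hτ : 0 < τ i) {s : State I m} (hx : s.x i ∈ P.X) {z : Vec m} (hz : z ∈ P.X) :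
    0 ≤ inner ℝ (gradient (fun w => ft i w (s.x i)) (localSol P ft s i) +
        ((I : ℝ) • s.y i - gradient (P.f i) (s.x i))) (z - localSol P ft s i) +
      (P.G z - P.G (localSol P ft s i)) := by
  obtain ⟨hmem, hmin⟩ := argminOn_mem (hS.existsUnique_localModel hP hτ hx)
  set c := (I : ℝ) • s.y i - gradient (P.f i) (s.x i) with hc
  refine inner_add_sub_nonneg_of_isMinOn hP.convexOn_G hmem
    (g := fun z => ft i z (s.x i) + inner ℝ c (z - s.x i)) (fun w hw => hmin hw) ?_ hz
  have h0 := (hP.hasGradientAt_of_contDiffOn (hS.smooth i _ hx) hmem).hasFDerivAt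
  change HasGradientAt _ _ (argminOn P.X (localModel P ft s i))
  rw [hasGradientAt_iff_hasFDerivAt]
  have h1 : HasFDerivAt (fun y : Vec m => y - s.x i) (ContinuousLinearMap.id ℝ (Vec m))
    (argminOn P.X (localModel P ft s i)) := (hasFDerivAt_id _).sub_const _
  have h2 := h0.add ((hasFDerivAt_const c _).inner ℝ h1)
  refine h2.congr_fderiv ?_
  ext w
  simp [localSol]

/-- Test optimality at the current point; strong monotonicity of the surrogate gradient gives the
quadratic term, and gradient consistency cancels ∇f_i. -/
theorem IsSurrogate.inner_localSol_le (hS : IsSurrogate P ft τ Lt) (hP : P.Regular L)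
    {i : Fin I} (hτ : 0 < τ i) {s : State I m} (hx : s.x i ∈ P.X) :
    inner ℝ ((I : ℝ) • s.y i) (localSol P ft s i - s.x i) +
      (P.G (localSol P ft s i) - P.G (s.x i)) ≤ -(τ i * ‖localSol P ft s i - s.x i‖ ^ 2) := by
  have hmem := hS.localSol_mem hP hτ hx
  have h1 := hS.localSol_optimality hP hτ hx hx
  have h2 := (hS.strongConvex i _ hx).le_inner_sub hmem hx
    (hP.hasGradientAt_of_contDiffOn (hS.smooth i _ hx) hmem)
    (hP.hasGradientAt_of_contDiffOn (hS.smooth i _ hx) hx)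
  rw [hS.consistent i _ hx] at h2
  rw [← neg_sub (localSol P ft s i) (s.x i), inner_neg_right, inner_add_left, inner_sub_left] at h1
  rw [inner_sub_left] at h2
  linarith

/-- Lipschitz dependence of the local solution on (x_i, y_i), which later prevents the search
directions from varying quickly. -/
theorem IsSurrogate.norm_localSol_sub_le (hS : IsSurrogate P ft τ Lt) (hP : P.Regular L)
    {i : Fin I} (hτ : 0 < τ i) {s s' : State I m} (hx : s.x i ∈ P.X) (hx' : s'.x i ∈ P.X) :
    τ i * ‖localSol P ft s i - localSol P ft s' i‖ ≤
      (Lt i + L i) * ‖s.x i - s'.x i‖ + I * ‖s.y i - s'.y i‖ := by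
  have hmem := hS.localSol_mem hP hτ hx
  have hmem' := hS.localSol_mem hP hτ hx'
  have h1 := inner_sub_nonneg_of_optimality (hS.localSol_optimality hP hτ hx hmem')
    (hS.localSol_optimality hP hτ hx' hmem)
  set q := localSol P ft s i
  set q' := localSol P ft s' i
  have h2 := (hS.strongConvex i _ hx).le_inner_sub hmem hmem'
    (hP.hasGradientAt_of_contDiffOn (hS.smooth i _ hx) hmem)
    (hP.hasGradientAt_of_contDiffOn (hS.smooth i _ hx) hmem')
  set u := gradient (fun w => ft i w (s'.x i)) q' - gradient (fun w => ft i w (s.x i)) q' with hu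
  set w := gradient (P.f i) (s.x i) - gradient (P.f i) (s'.x i) with hw
  set r := (I : ℝ) • (s.y i - s'.y i) with hr
  have h3 : τ i * ‖q - q'‖ ^ 2 ≤ inner ℝ (u + w - r) (q - q') := by
    rw [← neg_sub q q', inner_neg_right] at h1
    have e : gradient (fun w => ft i w (s.x i)) q +
          ((I : ℝ) • s.y i - gradient (P.f i) (s.x i)) -
        (gradient (fun w => ft i w (s'.x i)) q' +
          ((I : ℝ) • s'.y i - gradient (P.f i) (s'.x i))) =
        (gradient (fun w => ft i w (s.x i)) q - gradient (fun w => ft i w (s.x i)) q') -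
          (u + w - r) := by
      rw [hu, hw, hr]; module
    rw [e, inner_sub_left] at h1
    linarith
  refine (norm_le_of_inner_nonneg h3).trans ?_
  have n1 : ‖u‖ ≤ Lt i * ‖s.x i - s'.x i‖ := by
    rw [norm_sub_rev (s.x i)]; exact (hS.lipschitz i _ hmem').norm_sub_le hx' hx
  have n2 : ‖w‖ ≤ L i * ‖s.x i - s'.x i‖ := (hP.lipschitz i).norm_sub_le hx hx'
  have n3 : ‖r‖ = I * ‖s.y i - s'.y i‖ := by
    rw [hr, norm_smul, Real.norm_of_nonneg (Nat.cast_nonneg I)]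
  linarith [norm_sub_le (u + w) r, norm_add_le u w]

/-- The local and the proximal problem differ by a tracking error and by terms controlled by the
search direction and the distance to z; strong monotonicity turns this into closeness of their
solutions. -/
theorem IsSurrogate.J_le (hS : IsSurrogate P ft τ Lt) (hP : P.Regular L)
    {i : Fin I} (hτ : 0 < τ i) {s : State I m} (hx : s.x i ∈ P.X) {z : Vec m} :
    P.J z ≤ 2 * ‖s.x i - z‖ + (2 + Lt i + L i) * ‖localSol P ft s i - s.x i‖ +
      ‖(I : ℝ) • s.y i - gradient P.F z‖ := by
  have hmem := hS.localSol_mem hP hτ hx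
  have hp := (argminOn_mem (hP.existsUnique_proxModel z)).1
  have h1 := inner_sub_nonneg_of_optimality (hP.proxModel_optimality z hmem)
    (hS.localSol_optimality hP hτ hx hp)
  rw [Problem.J]
  set p := argminOn P.X (P.proxModel z)
  set q := localSol P ft s i
  set u := gradient (P.f i) q - gradient (fun w => ft i w (s.x i)) q with hu
  set w := gradient (P.f i) (s.x i) - gradient (P.f i) q with hw
  set r := (I : ℝ) • s.y i - gradient P.F z with hr
  have h2 : 1 * ‖q - p‖ ^ 2 ≤ inner ℝ ((q - z) + u + w - r) (q - p) := by
    have e : gradient P.F z + (p - z) - (gradient (fun w => ft i w (s.x i)) q +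
          ((I : ℝ) • s.y i - gradient (P.f i) (s.x i))) =
        ((q - z) + u + w - r) - (q - p) := by
      rw [hu, hw, hr]; module
    rw [e, inner_sub_left, real_inner_self_eq_norm_sq] at h1
    linarith
  have h3 := norm_le_of_inner_nonneg h2
  have n1 : ‖u‖ ≤ Lt i * ‖q - s.x i‖ := by
    -- Writing ∇f_i(q) as the surrogate gradient at (q | q) leaves a variation in the second
    -- argument only, where Lipschitz continuity is available.
    rw [hu, ← hS.consistent i q hmem]
    exact (hS.lipschitz i _ hmem).norm_sub_le hmem hx
  have n2 : ‖w‖ ≤ L i * ‖q - s.x i‖ := by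
    rw [norm_sub_rev q]; exact (hP.lipschitz i).norm_sub_le hx hmem
  have n3 : ‖q - z‖ ≤ ‖q - s.x i‖ + ‖s.x i - z‖ := norm_sub_le_norm_sub_add_norm_sub _ _ _
  have n4 : ‖z - p‖ ≤ ‖q - z‖ + ‖q - p‖ := by
    rw [norm_sub_rev q z]; exact norm_sub_le_norm_sub_add_norm_sub _ _ _
  linarith [norm_sub_le ((q - z) + u + w) r, norm_add_le ((q - z) + u) w, norm_add_le (q - z) u]

end Local

/-! ### Stationarity of limit points. -/

theorem Problem.Regular.isDStationary_of_mapClusterPt {P : Problem I m} {L : Fin I → ℝ≥0}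
    (hP : P.Regular L) {x : ℕ → Vec m} (hx : ∀ k, x k ∈ P.X)
    (hJ : Tendsto (fun k => P.J (x k)) atTop (𝓝 0)) {z : Vec m} (hz : MapClusterPt z atTop x) :
    P.IsDStationary z := by
  -- An ultrafilter replaces extraction of a subsequence. Along it the proximal points share the
  -- limit z, because their distance to x is exactly `J`.
  obtain ⟨U, hU, hlim⟩ := mapClusterPt_iff_ultrafilter.1 hz
  have hzX : z ∈ P.X := hP.closed.mem_of_tendsto hlim (Eventually.of_forall hx)
  set p : ℕ → Vec m := fun k => argminOn P.X (P.proxModel (x k)) with hp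
  have hpX : ∀ k, p k ∈ P.X := fun k => (argminOn_mem (hP.existsUnique_proxModel (x k))).1
  have hdiff : Tendsto (fun k => p k - x k) U (𝓝 0) := by
    rw [tendsto_zero_iff_norm_tendsto_zero]
    refine (hJ.mono_left hU).congr fun k => ?_
    rw [Problem.J, norm_sub_rev]
  have hplim : Tendsto p U (𝓝 z) := by simpa using hdiff.add hlim
  have hgrad : Tendsto (fun k => gradient P.F (x k)) U (𝓝 (gradient P.F z)) :=
    (hP.lipschitzOnWith_gradient_F.continuousOn z hzX).tendsto.comp
      (tendsto_nhdsWithin_iff.2 ⟨hlim, Eventually.of_forall hx⟩)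
  have hGlim : Tendsto (fun k => P.G (p k)) U (𝓝 (P.G z)) :=
    (hP.continuousOn_G z hzX).tendsto.comp
      (tendsto_nhdsWithin_iff.2 ⟨hplim, Eventually.of_forall hpX⟩)
  have hopt : ∀ y ∈ P.X, 0 ≤ inner ℝ (gradient P.F z) (y - z) + (P.G y - P.G z) := fun y hy => by
    have h1 := ((hgrad.add hdiff).inner (𝕜 := ℝ) ((tendsto_const_nhds (x := y)).sub hplim)).add
      ((tendsto_const_nhds (x := P.G y)).sub hGlim)
    rw [add_zero] at h1
    exact ge_of_tendsto' h1 fun k => hP.proxModel_optimality (x k) hy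
  refine ⟨hzX, fun y hy => ?_⟩
  obtain ⟨v, hv⟩ := exists_tendsto_slope_of_convexOn_subsets hP.isOpen hP.convexG
    (hP.subset hzX) (y - z)
  have hF := (hP.hasGradientAt_F hzX).tendsto_slope (y - z)
  rw [← hP.gradient_F hzX] at hF
  refine ⟨inner ℝ (gradient P.F z) (y - z) + v, ?_, (hF.add hv).congr fun t => ?_⟩
  · refine ge_of_tendsto (hv.const_add _) ?_
    filter_upwards [pos_and_le_one_eventually] with t ⟨h0, h1⟩
    have := hopt _ (add_smul_sub_mem hP.convex hzX hy h0.le h1)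
    rw [add_sub_cancel_left, inner_smul_right] at this
    rw [add_div' _ _ _ h0.ne']
    exact div_nonneg (by linarith) h0.le
  · rw [Problem.V, Problem.V]; ring

variable {I m : ℕ}

theorem norm_sq_le_sum_norm_sq {ι E : Type*} [Fintype ι] [NormedAddCommGroup E]
    (x : ι → E) :
    ‖x‖ ^ 2 ≤ ∑ i, ‖x i‖ ^ 2 := by
  have h0 : 0 ≤ ∑ i, ‖x i‖ ^ 2 := Finset.sum_nonneg fun i _ => sq_nonneg _
  have : ‖x‖ ≤ √(∑ i, ‖x i‖ ^ 2) := (pi_norm_le_iff_of_nonneg (Real.sqrt_nonneg _)).2 fun i =>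
    Real.le_sqrt_of_sq_le (Finset.single_le_sum (f := fun i => ‖x i‖ ^ 2)
      (fun i _ => sq_nonneg _) (Finset.mem_univ i))
  exact (pow_le_pow_left₀ (norm_nonneg _) this 2).trans_eq (Real.sq_sqrt h0)

/-! ### Push-sum averaging and conserved averages. -/

section PushSum

variable {E : Type*} [NormedAddCommGroup E] [NormedSpace ℝ E]

theorem mix_smul {ι : Type*} [Fintype ι] (W : Matrix ι ι ℝ) (c : ℝ) (x : ι → E) :
    mix W (c • x) = c • mix W x := by
  ext i
  simp only [mix, Pi.smul_apply, Finset.smul_sum]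
  exact Finset.sum_congr rfl fun j _ => smul_comm _ _ _

theorem mix_transition_of_recurrence {ι : Type*} [Fintype ι] [DecidableEq ι]
    {A : ℕ → Matrix ι ι ℝ} {x : ℕ → ι → E} (hx : ∀ k, x (k + 1) = mix (A k) (x k)) (k n : ℕ) :
    x (k + n) = mix (transition A k n) (x k) := by
  induction n with
  | zero => rw [transition, mix_one, add_zero]
  | succ n ih => rw [transition, mix_mul, ← ih, ← hx, add_assoc]

/-- The average of `z` weighted by `φ`. -/
noncomputable def wavg (φ : Fin I → ℝ) (z : Fin I → E) : E := ∑ j, (φ j / I) • z j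

theorem wavg_add (φ : Fin I → ℝ) (z w : Fin I → E) : wavg φ (z + w) = wavg φ z + wavg φ w := by
  simp [wavg, smul_add, Finset.sum_add_distrib]

theorem wavg_smul (φ : Fin I → ℝ) (c : ℝ) (z : Fin I → E) : wavg φ (c • z) = c • wavg φ z := by
  simp only [wavg, Pi.smul_apply, Finset.smul_sum]
  exact Finset.sum_congr rfl fun j _ => smul_comm _ _ _

theorem wavg_mono {φ : Fin I → ℝ} (hφ : ∀ i, 0 ≤ φ i) {z w : Fin I → ℝ} (h : ∀ i, z i ≤ w i) :
    wavg φ z ≤ wavg φ w :=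
  Finset.sum_le_sum fun i _ =>
    smul_le_smul_of_nonneg_left (h i) (div_nonneg (hφ i) (Nat.cast_nonneg I))

theorem avg_eq_wavg (x : Fin I → Vec m) : avg x = wavg (fun _ => 1) x := by
  simp [avg, wavg, Finset.smul_sum]

theorem sum_div_card (hI : 0 < I) {φ : Fin I → ℝ} (h : ∑ i, φ i = I) :
    ∑ i, φ i / I = 1 := by
  rw [← Finset.sum_div, h, div_self (by positivity)]

/-- The row-stochastic matrix of push-sum averaging. -/
noncomputable def pushWeight (A : Matrix (Fin I) (Fin I) ℝ) (φ : Fin I → ℝ) :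
    Matrix (Fin I) (Fin I) ℝ :=
  fun i j => A i j * φ j / mix A φ i

theorem rowStochastic_pushWeight {A : Matrix (Fin I) (Fin I) ℝ} {φ : Fin I → ℝ}
    (hA : ∀ i j, 0 ≤ A i j) (hφ : ∀ i, 0 ≤ φ i) (hpos : ∀ i, 0 < mix A φ i) :
    RowStochastic (pushWeight A φ) where
  nonneg i j := div_nonneg (mul_nonneg (hA i j) (hφ j)) (hpos i).le
  sum_eq i := by
    simp only [pushWeight]
    rw [← Finset.sum_div]
    exact div_self (hpos i).ne'

/-- The new weight cancels the normalization of its row, after which the columns of A sum to one. -/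
theorem wavg_mix_pushWeight {A : Matrix (Fin I) (Fin I) ℝ} {φ : Fin I → ℝ}
    (hA : ColumnStochastic A) (hpos : ∀ i, 0 < mix A φ i) (z : Fin I → E) :
    wavg (mix A φ) (mix (pushWeight A φ) z) = wavg φ z := by
  have h : ∀ i, (mix A φ i / I) • mix (pushWeight A φ) z i =
      ∑ j, A i j • (φ j / I) • z j := fun i => by
    simp only [mix, pushWeight, Finset.smul_sum, smul_smul]
    refine Finset.sum_congr rfl fun j _ => ?_
    congr 1
    have : ∑ j, A i j • φ j ≠ 0 := (hpos i).ne'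
    field_simp
  simp only [wavg, h]
  rw [Finset.sum_comm]
  have hA' : ∀ j, ∑ i, A i j = 1 := hA
  simp_rw [← Finset.sum_smul, hA', one_smul]

end PushSum

/-! ### Invariants and estimates for one iteration. -/

variable {P : Problem I m} {L : Fin I → ℝ≥0} {ft : Fin I → Vec m → Vec m → ℝ} {τ : Fin I → ℝ}
  {Lt : Fin I → ℝ≥0} {A : Matrix (Fin I) (Fin I) ℝ} {γ : ℝ} {s : State I m}

/-- The local search directions. -/
noncomputable def dir (P : Problem I m) (ft : Fin I → Vec m → Vec m → ℝ) (s : State I m) :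
    Fin I → Vec m :=
  fun i => localSol P ft s i - s.x i

theorem half_eq : half P ft γ s = s.x + γ • dir P ft s := rfl

theorem smul_sum_eq_mix_pushWeight (z : Fin I → Vec m) (i : Fin I) :
    (1 / nextφ A s i) • ∑ j, (A i j * s.φ j) • z j = mix (pushWeight A s.φ) z i := by
  simp only [mix, pushWeight, Finset.smul_sum, smul_smul, nextφ, smul_eq_mul]
  exact Finset.sum_congr rfl fun j _ => by rw [one_div_mul_eq_div]

theorem step_x : (step P ft A γ s).x = mix (pushWeight A s.φ) (half P ft γ s) :=
  funext fun i => smul_sum_eq_mix_pushWeight _ i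

theorem step_φ : (step P ft A γ s).φ = mix A s.φ := rfl

/-- The variation of the local gradients that is fed into the gradient trackers. -/
noncomputable def innovation (P : Problem I m) (ft : Fin I → Vec m → Vec m → ℝ)
    (A : Matrix (Fin I) (Fin I) ℝ) (γ : ℝ) (s : State I m) : Fin I → Vec m :=
  fun i => (1 / mix A s.φ i) •
    (gradient (P.f i) ((step P ft A γ s).x i) - gradient (P.f i) (s.x i))

theorem step_y : (step P ft A γ s).y =
    mix (pushWeight A s.φ) s.y + innovation P ft A γ s :=
  funext fun i => congrArg (· + innovation P ft A γ s i) (smul_sum_eq_mix_pushWeight s.y i)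

/-- The invariants of the iteration: feasibility, and conservation of the total push-sum weight and
of the weighted sum of the gradient trackers. -/
structure State.Admissible (P : Problem I m) (s : State I m) : Prop where
  mem : ∀ i, s.x i ∈ P.X
  pos : ∀ i, 0 < s.φ i
  sum_φ : ∑ i, s.φ i = I
  tracking : wavg s.φ s.y = (1 / I : ℝ) • ∑ i, gradient (P.f i) (s.x i)

theorem Compliant.nonneg {κ : ℝ} (hκ : 0 < κ) {Γ : Digraph (Fin I)} (h : Compliant κ Γ A)
    (i j : Fin I) : 0 ≤ A i j := by
  by_cases hij : i = j
  · exact hij ▸ hκ.le.trans (h.diag i)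
  · by_cases hadj : Γ.Adj j i
    · exact hκ.le.trans (h.edge i j hadj)
    · exact (h.eq_zero i j hij hadj).ge

theorem le_mix_of_le_diag {κ : ℝ} (hA : ∀ i j, 0 ≤ A i j) (hd : ∀ i, κ ≤ A i i)
    {φ : Fin I → ℝ} (hφ : ∀ i, 0 ≤ φ i) (i : Fin I) : κ * φ i ≤ mix A φ i :=
  (mul_le_mul_of_nonneg_right (hd i) (hφ i)).trans
    (Finset.single_le_sum (f := fun j => A i j • φ j)
      (fun j _ => mul_nonneg (hA i j) (hφ j)) (Finset.mem_univ i))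

theorem State.Admissible.mix_pos (hs : s.Admissible P) {κ : ℝ} (hκ : 0 < κ)
    (hA : ∀ i j, 0 ≤ A i j) (hd : ∀ i, κ ≤ A i i) (i : Fin I) : 0 < mix A s.φ i :=
  (mul_pos hκ (hs.pos i)).trans_le (le_mix_of_le_diag hA hd (fun j => (hs.pos j).le) i)

theorem State.Admissible.half_mem (hs : s.Admissible P) (hP : P.Regular L)
    (hS : IsSurrogate P ft τ Lt) (hτ : ∀ i, 0 < τ i) (h0 : 0 ≤ γ) (h1 : γ ≤ 1) (i : Fin I) :
    half P ft γ s i ∈ P.X :=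
  add_smul_sub_mem hP.convex (hs.mem i) (hS.localSol_mem hP (hτ i) (hs.mem i)) h0 h1

theorem State.Admissible.wavg_mem (hs : s.Admissible P) (hP : P.Regular L) (hI : 0 < I) :
    wavg s.φ s.x ∈ P.X :=
  hP.convex.sum_mem (fun i _ => div_nonneg (hs.pos i).le (Nat.cast_nonneg I))
    (sum_div_card hI hs.sum_φ) fun i _ => hs.mem i

theorem State.Admissible.avg_mem (hs : s.Admissible P) (hP : P.Regular L) (hI : 0 < I) :
    avg s.x ∈ P.X := by
  rw [avg_eq_wavg]
  exact hP.convex.sum_mem (fun i _ => by positivity) (sum_div_card hI (by simp))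
    fun i _ => hs.mem i

theorem State.Admissible.step (hs : s.Admissible P) (hP : P.Regular L)
    (hS : IsSurrogate P ft τ Lt) (hI : 0 < I) (hτ : ∀ i, 0 < τ i) {κ : ℝ} (hκ : 0 < κ)
    (hA : ∀ i j, 0 ≤ A i j) (hd : ∀ i, κ ≤ A i i) (hc : ColumnStochastic A) (h0 : 0 ≤ γ)
    (h1 : γ ≤ 1) : (step P ft A γ s).Admissible P := by
  have hpos := hs.mix_pos hκ hA hd
  have hW := rowStochastic_pushWeight hA (fun i => (hs.pos i).le) hpos
  refine ⟨fun i => ?_, hpos, ?_, ?_⟩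
  · rw [step_x]
    exact hP.convex.sum_mem (fun j _ => hW.nonneg i j) (hW.sum_eq i)
      fun j _ => hs.half_mem hP hS hτ h0 h1 j
  · have hc' : ∀ j, ∑ i, A i j = 1 := hc
    simp only [step_φ, mix]
    rw [Finset.sum_comm]
    simp_rw [smul_eq_mul, ← Finset.sum_mul, hc', one_mul, hs.sum_φ]
  · rw [step_φ, step_y, wavg_add, wavg_mix_pushWeight hc hpos, hs.tracking]
    have : wavg (mix A s.φ) (innovation P ft A γ s) = (1 / I : ℝ) •
        ∑ i, (gradient (P.f i) ((Sonata.step P ft A γ s).x i) - gradient (P.f i) (s.x i)) := by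
      simp only [wavg, innovation, Finset.smul_sum, smul_smul]
      refine Finset.sum_congr rfl fun i _ => ?_
      congr 1
      have := (hpos i).ne'
      have hI' : (I : ℝ) ≠ 0 := by positivity
      field_simp
    rw [this, ← smul_add, Finset.sum_sub_distrib, add_sub_cancel]

theorem State.Admissible.norm_sub_wavg_le (hs : s.Admissible P) (hI : 0 < I) {E : Type*}
    [NormedAddCommGroup E] [NormedSpace ℝ E] (z : Fin I → E) (i : Fin I) :
    ‖z i - wavg s.φ z‖ ≤ spread z :=
  norm_sub_sum_smul_le_spread (fun i => div_nonneg (hs.pos i).le (Nat.cast_nonneg I))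
    (sum_div_card hI hs.sum_φ) z i

theorem norm_sub_avg_le (hI : 0 < I) (x : Fin I → Vec m) (i : Fin I) :
    ‖x i - avg x‖ ≤ spread x := by
  rw [avg_eq_wavg]
  exact norm_sub_sum_smul_le_spread (fun _ => by positivity) (sum_div_card hI (by simp)) x i

theorem State.Admissible.norm_wavg_le (hs : s.Admissible P) (hI : 0 < I) (z : Fin I → Vec m) :
    ‖wavg s.φ z‖ ≤ ‖z‖ := by
  have := norm_sum_smul_le (fun i => div_nonneg (hs.pos i).le (Nat.cast_nonneg I))
    fun i => norm_le_pi_norm z i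
  rwa [sum_div_card hI hs.sum_φ, one_mul] at this

/-- The error splits into I times the deviation of y_i from the weighted tracker average, which by
conservation is the mean of the local gradients, and the variation of these gradients between the
copies and z. -/
theorem State.Admissible.tracking_error_le (hs : s.Admissible P) (hP : P.Regular L) (hI : 0 < I)
    {z : Vec m} (hz : z ∈ P.X) (hD : ∀ i, ‖s.x i - z‖ ≤ spread s.x) (i : Fin I) :
    ‖(I : ℝ) • s.y i - gradient P.F z‖ ≤ I * spread s.y + (∑ i, (L i : ℝ)) * spread s.x := by
  have hI' : (I : ℝ) ≠ 0 := by positivity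
  have e : (I : ℝ) • s.y i - gradient P.F z = (I : ℝ) • (s.y i - wavg s.φ s.y) +
      (∑ i, gradient (P.f i) (s.x i) - gradient P.F z) := by
    rw [hs.tracking, smul_sub, smul_smul, mul_one_div_cancel hI', one_smul]
    abel
  rw [e]
  refine (norm_add_le _ _).trans (add_le_add ?_ (hP.norm_sum_gradient_sub_le hs.mem hz hD))
  rw [norm_smul, Real.norm_of_nonneg (Nat.cast_nonneg I)]
  exact mul_le_mul_of_nonneg_left (hs.norm_sub_wavg_le hI s.y i) (Nat.cast_nonneg I)

theorem norm_mix_half_sub_le {W : Matrix (Fin I) (Fin I) ℝ} (hW : RowStochastic W)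
    (h0 : 0 ≤ γ) (i : Fin I) :
    ‖mix W (half P ft γ s) i - s.x i‖ ≤ spread s.x + γ * ‖dir P ft s‖ := by
  have : Nonempty (Fin I) := ⟨i⟩
  have e : mix W (half P ft γ s) i - s.x i =
      -(s.x i - ∑ j, W i j • s.x j) + γ • mix W (dir P ft s) i := by
    rw [half_eq, mix_add, mix_smul, Pi.add_apply, Pi.smul_apply]
    simp only [mix]
    abel
  rw [e]
  refine (norm_add_le _ _).trans (add_le_add ?_ ?_)
  · rw [norm_neg]; exact norm_sub_sum_smul_le_spread (hW.nonneg i) (hW.sum_eq i) s.x i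
  · rw [norm_smul, Real.norm_of_nonneg h0]
    exact mul_le_mul_of_nonneg_left ((norm_le_pi_norm _ i).trans (hW.norm_mix_le _)) h0

theorem State.Admissible.norm_innovation_le (hs : s.Admissible P)
    (hs' : (Sonata.step P ft A γ s).Admissible P) (hP : P.Regular L)
    {φ₀ D : ℝ} (hφ₀ : 0 < φ₀) (hφ : ∀ i, φ₀ ≤ mix A s.φ i) (hD0 : 0 ≤ D)
    (hD : ∀ i, ‖(Sonata.step P ft A γ s).x i - s.x i‖ ≤ D) :
    ‖innovation P ft A γ s‖ ≤ (∑ i, (L i : ℝ)) / φ₀ * D := by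
  have hL0 : 0 ≤ ∑ i, (L i : ℝ) := Finset.sum_nonneg fun i _ => (L i).2
  refine (pi_norm_le_iff_of_nonneg (by positivity)).2 fun i => ?_
  have hpos := hφ₀.trans_le (hφ i)
  rw [innovation, norm_smul, Real.norm_of_nonneg (by positivity), one_div_mul_eq_div,
    div_mul_eq_mul_div]
  refine div_le_div₀ (by positivity) ?_ hφ₀ (hφ i)
  refine ((hP.lipschitz i).norm_sub_le (hs'.mem i) (hs.mem i)).trans ?_
  exact mul_le_mul (Finset.single_le_sum (f := fun i => (L i : ℝ)) (fun i _ => (L i).2)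
    (Finset.mem_univ i)) (hD i) (norm_nonneg _) hL0

/-- The Lyapunov function: `F` at the weighted average plus the weighted average of `G`. -/
noncomputable def energy (P : Problem I m) (s : State I m) : ℝ :=
  P.F (wavg s.φ s.x) + wavg s.φ fun i => P.G (s.x i)

theorem State.Admissible.le_energy (hs : s.Admissible P) (hP : P.Regular L) (hI : 0 < I) :
    P.V (wavg s.φ s.x) ≤ energy P s :=
  add_le_add_right (hP.convexOn_G.map_sum_le
    (fun i _ => div_nonneg (hs.pos i).le (Nat.cast_nonneg I))
    (sum_div_card hI hs.sum_φ) fun i _ => hs.mem i) _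

/-- The weighted average of x moves exactly by γ times that of the directions, so the descent lemma
handles F; Jensen handles G through the mixing and convexity through the local step. Replacing ∇F by
I·y_i in `inner_localSol_le` costs the tracking error times d. -/
theorem State.Admissible.energy_step_le (hs : s.Admissible P) (hP : P.Regular L)
    (hS : IsSurrogate P ft τ Lt) (hI : 0 < I) (hτ : ∀ i, 0 < τ i) {κ : ℝ} (hκ : 0 < κ)
    (hA : ∀ i j, 0 ≤ A i j) (hd : ∀ i, κ ≤ A i i) (hc : ColumnStochastic A) (h0 : 0 ≤ γ)
    (h1 : γ ≤ 1) {φ₀ τ₀ : ℝ} (hφ₀ : 0 ≤ φ₀) (hφ : ∀ i, φ₀ ≤ s.φ i) (hτ₀ : 0 ≤ τ₀)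
    (hττ : ∀ i, τ₀ ≤ τ i) :
    energy P (Sonata.step P ft A γ s) ≤ energy P s - φ₀ * τ₀ / I * γ * ‖dir P ft s‖ ^ 2 +
      (I + ∑ i, (L i : ℝ)) * γ * ‖dir P ft s‖ * (spread s.x + spread s.y) +
      (∑ i, (L i : ℝ)) * γ ^ 2 * ‖dir P ft s‖ ^ 2 := by
  have hpos := hs.mix_pos hκ hA hd
  have hφnn : ∀ i, 0 ≤ s.φ i := fun i => (hs.pos i).le
  have hpn : ∀ i, 0 ≤ s.φ i / I := fun i => div_nonneg (hφnn i) (Nat.cast_nonneg I)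
  have hW := rowStochastic_pushWeight hA hφnn hpos
  have hs' := hs.step hP hS hI hτ hκ hA hd hc h0 h1
  set Ls := ∑ i, (L i : ℝ) with hLs
  have hLs0 : 0 ≤ Ls := Finset.sum_nonneg fun i _ => (L i).2
  set d := ‖dir P ft s‖ with hdd
  have hd0 : 0 ≤ d := norm_nonneg _
  set w := wavg s.φ s.x with hw
  have hwX : w ∈ P.X := hs.wavg_mem hP hI
  have hmove : wavg (mix A s.φ) (Sonata.step P ft A γ s).x = w + γ • wavg s.φ (dir P ft s) := by
    rw [step_x, wavg_mix_pushWeight hc hpos, half_eq, wavg_add, wavg_smul]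
  have hF : P.F (w + γ • wavg s.φ (dir P ft s)) ≤ P.F w +
      γ * (∑ i, s.φ i / I * inner ℝ (gradient P.F w) (dir P ft s i)) + Ls * γ ^ 2 * d ^ 2 := by
    have h := sub_le_inner_add_of_lipschitzOnWith hP.convex
      (fun x hx => (hP.hasGradientAt_F hx).differentiableAt.hasGradientAt)
      hP.lipschitzOnWith_gradient_F hwX (hmove ▸ hs'.wavg_mem hP hI)
    rw [add_sub_cancel_left, inner_smul_right, norm_smul, Real.norm_of_nonneg h0, wavg, inner_sum,
      ← wavg, NNReal.coe_sum, ← hLs] at h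
    simp only [inner_smul_right] at h
    have h2 : Ls * (γ * ‖wavg s.φ (dir P ft s)‖) ^ 2 ≤ Ls * (γ * d) ^ 2 := by
      have := hs.norm_wavg_le hI (dir P ft s)
      gcongr
    rw [mul_pow γ d] at h2
    linarith
  have hG : wavg (mix A s.φ) (fun i => P.G ((Sonata.step P ft A γ s).x i)) ≤
      wavg s.φ (fun i => P.G (s.x i)) +
        γ * ∑ i, s.φ i / I * (P.G (localSol P ft s i) - P.G (s.x i)) := by
    calc wavg (mix A s.φ) (fun i => P.G ((Sonata.step P ft A γ s).x i))
        ≤ wavg (mix A s.φ) (mix (pushWeight A s.φ) fun i => P.G (half P ft γ s i)) := by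
          refine wavg_mono (fun i => (hpos i).le) fun i => ?_
          rw [step_x]
          exact hP.convexOn_G.map_sum_le (fun j _ => hW.nonneg i j) (hW.sum_eq i)
            fun j _ => hs.half_mem hP hS hτ h0 h1 j
      _ = wavg s.φ fun i => P.G (half P ft γ s i) := wavg_mix_pushWeight hc hpos _
      _ ≤ wavg s.φ ((fun i => P.G (s.x i)) +
            γ • fun i => P.G (localSol P ft s i) - P.G (s.x i)) :=
          wavg_mono hφnn fun i => hP.convexOn_G.map_add_smul_sub_le (hs.mem i)
            (hS.localSol_mem hP (hτ i) (hs.mem i)) h0 h1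
      _ = _ := by rw [wavg_add, wavg_smul]; rfl
  set e := I * spread s.y + Ls * spread s.x with he
  have hterm : ∀ i, s.φ i / I * (inner ℝ (gradient P.F w) (dir P ft s i) +
      (P.G (localSol P ft s i) - P.G (s.x i))) ≤
      -(φ₀ * τ₀ / I * ‖dir P ft s i‖ ^ 2) + s.φ i / I * (e * d) := fun i => by
    have t1 := hS.inner_localSol_le hP (hτ i) (hs.mem i)
    have t2 : -inner ℝ ((I : ℝ) • s.y i - gradient P.F w) (dir P ft s i) ≤ e * d := by
      refine (neg_le_abs _).trans ((abs_real_inner_le_norm _ _).trans ?_)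
      exact mul_le_mul (hs.tracking_error_le hP hI hwX (hs.norm_sub_wavg_le hI s.x) i)
        (norm_le_pi_norm (dir P ft s) i) (norm_nonneg _)
        (add_nonneg (mul_nonneg (Nat.cast_nonneg I) (spread_nonneg _))
          (mul_nonneg hLs0 (spread_nonneg _)))
    rw [inner_sub_left] at t2
    change inner ℝ ((I : ℝ) • s.y i) (dir P ft s i) + _ ≤ -(τ i * ‖dir P ft s i‖ ^ 2) at t1
    have t3 : inner ℝ (gradient P.F w) (dir P ft s i) +
        (P.G (localSol P ft s i) - P.G (s.x i)) ≤ -(τ i * ‖dir P ft s i‖ ^ 2) + e * d := by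
      linarith
    have t4 := mul_le_mul_of_nonneg_left t3 (hpn i)
    have t5 : φ₀ * τ₀ / I * ‖dir P ft s i‖ ^ 2 ≤ s.φ i / I * (τ i * ‖dir P ft s i‖ ^ 2) := by
      rw [mul_div_right_comm, mul_assoc]
      have := hφ i; have := hττ i; have := hpn i
      gcongr
    linarith
  have hsum : ∑ i, s.φ i / I * (inner ℝ (gradient P.F w) (dir P ft s i) +
      (P.G (localSol P ft s i) - P.G (s.x i))) ≤ -(φ₀ * τ₀ / I * d ^ 2) + e * d := by
    refine (Finset.sum_le_sum fun i _ => hterm i).trans ?_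
    rw [Finset.sum_add_distrib, Finset.sum_neg_distrib, ← Finset.mul_sum, ← Finset.sum_mul,
      sum_div_card hI hs.sum_φ, one_mul]
    have := mul_le_mul_of_nonneg_left (norm_sq_le_sum_norm_sq (dir P ft s))
      (by positivity : 0 ≤ φ₀ * τ₀ / I)
    linarith
  have hγsum := mul_le_mul_of_nonneg_left hsum h0
  simp only [mul_add, Finset.sum_add_distrib] at hγsum
  have he' : γ * (e * d) ≤ (I + Ls) * γ * d * (spread s.x + spread s.y) := by
    have e1 : 0 ≤ γ * d * (I * spread s.x + Ls * spread s.y) := by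
      have := spread_nonneg s.x; have := spread_nonneg s.y
      positivity
    rw [he]
    linarith
  rw [energy, energy, step_φ, hmove]
  linarith

theorem State.Admissible.norm_dir_step_le (hs : s.Admissible P)
    (hs' : (Sonata.step P ft A γ s).Admissible P) (hP : P.Regular L)
    (hS : IsSurrogate P ft τ Lt) (hτ : ∀ i, 0 < τ i) {τ₀ δx δy : ℝ} (hτ₀ : 0 < τ₀)
    (hττ : ∀ i, τ₀ ≤ τ i) (hδx0 : 0 ≤ δx) (hδy0 : 0 ≤ δy)
    (hδx : ∀ i, ‖(Sonata.step P ft A γ s).x i - s.x i‖ ≤ δx)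
    (hδy : ∀ i, ‖(Sonata.step P ft A γ s).y i - s.y i‖ ≤ δy) :
    ‖dir P ft (Sonata.step P ft A γ s)‖ ≤ ‖dir P ft s‖ +
      (τ₀⁻¹ * ((∑ i, (Lt i : ℝ) + ∑ i, (L i : ℝ)) * δx + I * δy) + δx) := by
  have hL0 : 0 ≤ ∑ i, (L i : ℝ) := Finset.sum_nonneg fun i _ => (L i).2
  have hLt0 : 0 ≤ ∑ i, (Lt i : ℝ) := Finset.sum_nonneg fun i _ => (Lt i).2
  refine (norm_le_norm_add_norm_sub' _ (dir P ft s)).trans (add_le_add_right ?_ _)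
  refine (pi_norm_le_iff_of_nonneg (by positivity)).2 fun i => ?_
  have e : (dir P ft (Sonata.step P ft A γ s) - dir P ft s) i =
      (localSol P ft (Sonata.step P ft A γ s) i - localSol P ft s i) -
        ((Sonata.step P ft A γ s).x i - s.x i) := by
    simp only [dir, Pi.sub_apply]; abel
  rw [e]
  refine (norm_sub_le _ _).trans (add_le_add ?_ (hδx i))
  have h1 := hS.norm_localSol_sub_le hP (hτ i) (hs'.mem i) (hs.mem i)
  have h2 := mul_le_mul_of_nonneg_right (hττ i)
    (norm_nonneg (localSol P ft (Sonata.step P ft A γ s) i - localSol P ft s i))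
  have hLi : (L i : ℝ) ≤ ∑ i, (L i : ℝ) :=
    Finset.single_le_sum (f := fun i => (L i : ℝ)) (fun i _ => (L i).2) (Finset.mem_univ i)
  have hLti : (Lt i : ℝ) ≤ ∑ i, (Lt i : ℝ) :=
    Finset.single_le_sum (f := fun i => (Lt i : ℝ)) (fun i _ => (Lt i).2) (Finset.mem_univ i)
  rw [le_inv_mul_iff₀ hτ₀]
  refine h2.trans (h1.trans (add_le_add ?_ ?_))
  · exact mul_le_mul (add_le_add hLti hLi) (hδx i) (norm_nonneg _) (by positivity)
  · exact mul_le_mul_of_nonneg_left (hδy i) (Nat.cast_nonneg I)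

theorem disagreement_sq_le (hI : 0 < I) (x : Fin I → Vec m) :
    disagreement x ^ 2 ≤ I * spread x ^ 2 := by
  rw [disagreement, Real.sq_sqrt (Finset.sum_nonneg fun i _ => sq_nonneg _)]
  refine (Finset.sum_le_sum fun i _ =>
    pow_le_pow_left₀ (norm_nonneg _) (norm_sub_avg_le hI x i) 2).trans_eq ?_
  simp

/-! ### Uniform bounds along the run and conclusion. -/

variable {I m : ℕ}

theorem Compliant.kappa_le_one (hI : 0 < I) {κ : ℝ} (hκ : 0 < κ) {Γ : Digraph (Fin I)}
    {A : Matrix (Fin I) (Fin I) ℝ} (h : Compliant κ Γ A) (hc : ColumnStochastic A) : κ ≤ 1 :=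
  (h.diag ⟨0, hI⟩).trans ((Finset.single_le_sum (f := fun i => A i ⟨0, hI⟩)
    (fun i _ => h.nonneg hκ i _) (Finset.mem_univ _)).trans_eq (hc _))

theorem pow_le_of_recurrence {B : ℕ} (hI : 0 < I) {κ : ℝ} (hκ : 0 < κ) (hκ1 : κ ≤ 1)
    {Γ : ℕ → Digraph (Fin I)} {A : ℕ → Matrix (Fin I) (Fin I) ℝ} (hΓ : BStronglyConnected B Γ)
    (hA : ∀ k, Compliant κ (Γ k) (A k)) {φ : ℕ → Fin I → ℝ} (hφ0 : ∀ i, φ 0 i = 1)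
    (hφ : ∀ k, φ (k + 1) = mix (A k) (φ k)) (hnn : ∀ k i, 0 ≤ φ k i)
    (hsum : ∀ k, ∑ i, φ k i = I) (k : ℕ) (i : Fin I) : κ ^ (I * B) ≤ φ k i := by
  -- Before time I·B the self-weights alone suffice; afterwards every entry of the last I·B-step
  -- product is bounded below and acts on total mass I.
  rcases lt_or_ge k (I * B) with hk | hk
  · have h : ∀ k i, κ ^ k ≤ φ k i := by
      intro k
      induction k with
      | zero => exact fun i => by rw [hφ0, pow_zero]
      | succ k ih =>
        intro i
        rw [hφ, pow_succ']
        exact (mul_le_mul_of_nonneg_left (ih i) hκ.le).trans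
          (le_mix_of_le_diag ((hA k).nonneg hκ) (hA k).diag (hnn k) i)
    exact (pow_le_pow_of_le_one hκ.le hκ1 hk.le).trans (h k i)
  · obtain ⟨l, rfl⟩ : ∃ l, k = l + I * B := ⟨k - I * B, by omega⟩
    rw [mix_transition_of_recurrence hφ]
    have hT := hΓ.pow_le_transition hκ (fun k => (hA k).nonneg hκ) (fun k => (hA k).diag)
      (fun k => (hA k).edge) l i
    calc κ ^ (I * B) ≤ κ ^ (I * B) * I :=
          le_mul_of_one_le_right (by positivity) (by exact_mod_cast hI)
      _ = ∑ j, κ ^ (I * B) * φ l j := by rw [← Finset.mul_sum, hsum]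
      _ ≤ _ := Finset.sum_le_sum fun j _ => mul_le_mul_of_nonneg_right (hT j) (hnn l j)

theorem le_pushWeight {A : Matrix (Fin I) (Fin I) ℝ} {φ : Fin I → ℝ} {κ φ₀ : ℝ}
    (hκ : 0 ≤ κ) (hφ₀ : 0 ≤ φ₀) (hφ : ∀ i, φ₀ ≤ φ i) (hpos : ∀ i, 0 < mix A φ i)
    (hsum : ∑ i, mix A φ i = I) {i j : Fin I} (hij : κ ≤ A i j) :
    κ * φ₀ / I ≤ pushWeight A φ i j := by
  have hle : mix A φ i ≤ I := hsum ▸ Finset.single_le_sum (f := fun i => mix A φ i)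
    (fun i _ => (hpos i).le) (Finset.mem_univ i)
  exact div_le_div₀ (mul_nonneg (hκ.trans hij) (hφ₀.trans (hφ j)))
    (mul_le_mul hij (hφ j) hφ₀ (hκ.trans hij)) (hpos i) hle

/-- Along the iteration, the search directions and the spreads of the local copies and of the
gradient trackers vanish. -/
theorem exists_stepsize_tendsto {B : ℕ} (hI : 0 < I) (hB : 0 < B) {κ : ℝ} (hκ : 0 < κ)
    (hκ1 : κ ≤ 1) {τ : Fin I → ℝ} (hτ : ∀ i, 0 < τ i) (L Lt : Fin I → ℝ≥0) :
    ∃ γbar : ℝ, 0 < γbar ∧ γbar ≤ 1 ∧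
      ∀ (m : ℕ) (P : Problem I m) (ft : Fin I → Vec m → Vec m → ℝ)
        (Γ : ℕ → Digraph (Fin I)) (A : ℕ → Matrix (Fin I) (Fin I) ℝ) (γ : ℕ → ℝ)
        (s : ℕ → State I m), P.Regular L → IsSurrogate P ft τ Lt → BStronglyConnected B Γ →
        (∀ k, Compliant κ (Γ k) (A k)) → (∀ k, ColumnStochastic (A k)) →
        (∀ k, 0 ≤ γ k ∧ γ k ≤ 1) → (∀ᶠ k in atTop, γ k ≤ γbar) →
        Tendsto (fun n => ∑ k ∈ Finset.range n, γ k) atTop atTop →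
        (∀ k, (s k).Admissible P) → (∀ i, (s 0).φ i = 1) →
        (∀ k, s (k + 1) = step P ft (A k) (γ k) (s k)) →
        Tendsto (fun k => ‖dir P ft (s k)‖) atTop (𝓝 0) ∧
        Tendsto (fun k => spread (s k).x) atTop (𝓝 0) ∧
        Tendsto (fun k => spread (s k).y) atTop (𝓝 0) := by
  have : Nonempty (Fin I) := ⟨⟨0, hI⟩⟩
  obtain ⟨i₀, hi₀⟩ := Finite.exists_min τ
  set τ₀ := τ i₀
  have hτ₀ : 0 < τ₀ := hτ i₀
  set N := I * B with hN
  have hN0 : 0 < N := Nat.mul_pos hI hB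
  have hI1 : (1 : ℝ) ≤ I := by exact_mod_cast hI
  set φ₀ := κ ^ N with hφ₀d
  have hφ₀ : 0 < φ₀ := by positivity
  set κ' := κ * φ₀ / I with hκ'
  have hκ'0 : 0 < κ' := by positivity
  have hκ'1 : κ' ≤ 1 := by
    rw [hκ', div_le_one (by positivity)]
    exact (mul_le_one₀ hκ1 hφ₀.le (pow_le_one₀ hκ.le hκ1)).trans hI1
  set η := κ' ^ N
  have hη0 : 0 < η := by positivity
  have hη1 : η ≤ 1 := pow_le_one₀ hκ'0.le hκ'1
  have hN1 : (1 : ℝ) ≤ N := by exact_mod_cast hN0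
  -- By Bernoulli ρ^N ≥ 1 - η/2, and the factor 2 also keeps ρ ≥ 1/2, so that ρ⁻¹ makes sense in the
  -- adapted seminorm.
  set ρ := 1 - η / (2 * N) with hρ
  have hfrac : η / (2 * N) ≤ 1 / 2 := by
    rw [div_le_iff₀ (by positivity)]; linarith
  have hρ0 : 0 < ρ := by linarith
  have hρ1 : ρ < 1 := by
    have : 0 < η / (2 * N) := by positivity
    linarith
  have hρN : 1 - η ≤ ρ ^ N := by
    have h := one_add_mul_le_pow (a := -(η / (2 * N))) (by linarith) N
    have e : (N : ℝ) * -(η / (2 * N)) = -(η / 2) := by field_simp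
    rw [e, ← sub_eq_add_neg, ← sub_eq_add_neg] at h
    linarith
  set C := 2 * ∑ n ∈ Finset.range N, ρ⁻¹ ^ n with hC
  have hC0 : 0 ≤ C := by positivity
  set Ls := ∑ i, (L i : ℝ)
  have hLs : 0 ≤ Ls := Finset.sum_nonneg fun i _ => (L i).2
  set Lts := ∑ i, (Lt i : ℝ)
  have hLts : 0 ≤ Lts := Finset.sum_nonneg fun i _ => (Lt i).2
  -- All constants are fixed before the dimension, the problem and the network are introduced, so
  -- the threshold is uniform in them.
  obtain ⟨γbar, hγb0, hγb1, key⟩ := exists_stepsize_bound (c₁ := φ₀ * τ₀ / I) (c₂ := I + Ls)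
    (c₃ := Ls) (c₄ := C) (c₅ := C * (Ls / φ₀))
    (c₆ := τ₀⁻¹ * ((Lts + Ls) + I * (1 + Ls / φ₀)) + 1)
    (by positivity) hLs hC0 (by positivity) (by positivity) hρ0.le hρ1
  refine ⟨γbar, hγb0, hγb1, ?_⟩
  intro m P ft Γ A γ s hP hS hΓ hA hc hγ hγbar hγsum hadm hφ1 hs
  have hAnn : ∀ k i j, 0 ≤ A k i j := fun k => (hA k).nonneg hκ
  have hnn : ∀ k i, 0 ≤ (s k).φ i := fun k i => ((hadm k).pos i).le
  have hφstep : ∀ k, (s (k + 1)).φ = mix (A k) (s k).φ := fun k => by rw [hs, step_φ]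
  have hφ : ∀ k i, φ₀ ≤ (s k).φ i := pow_le_of_recurrence hI hκ hκ1 hΓ hA
    (φ := fun k => (s k).φ) hφ1 hφstep hnn fun k => (hadm k).sum_φ
  have hpos : ∀ k i, 0 < mix (A k) (s k).φ i := fun k => (hadm k).mix_pos hκ (hAnn k) (hA k).diag
  set W : ℕ → Matrix (Fin I) (Fin I) ℝ := fun k => pushWeight (A k) (s k).φ with hWd
  have hW : ∀ k, RowStochastic (W k) := fun k =>
    rowStochastic_pushWeight (hAnn k) (hnn k) (hpos k)
  have hWlow : ∀ k i j, κ ≤ A k i j → κ' ≤ W k i j := fun k i j hij =>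
    le_pushWeight hκ.le hφ₀.le (hφ k) (hpos k) (hφstep k ▸ (hadm (k + 1)).sum_φ) hij
  have hT : ∀ k i j, η ≤ transition W k N i j := hΓ.pow_le_transition hκ'0
    (fun k => (hW k).nonneg) (fun k i => hWlow k i i ((hA k).diag i))
    (fun k i j h => hWlow k i j ((hA k).edge i j h))
  have hx : ∀ k, (s (k + 1)).x = mix (W k) (s k).x + γ k • mix (W k) (dir P ft (s k)) := fun k => by
    rw [hs, step_x, half_eq, mix_add, mix_smul]
  have hy : ∀ k, (s (k + 1)).y = mix (W k) (s k).y + innovation P ft (A k) (γ k) (s k) :=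
    fun k => by rw [hs, step_y]
  obtain ⟨Sx, hSx, hSxrec⟩ := exists_consensus_bound hW hN0 hη0.le hρ0 hρN hT
    (x := fun k => (s k).x) hx
  obtain ⟨Sy, hSy, hSyrec⟩ := exists_consensus_bound hW hN0 hη0.le hρ0 hρN hT
    (x := fun k => (s k).y) hy
  rw [← hC] at hSxrec hSyrec
  set d : ℕ → ℝ := fun k => ‖dir P ft (s k)‖ with hd
  have hd0 : ∀ k, 0 ≤ d k := fun k => norm_nonneg _
  have hSx0 : ∀ k, 0 ≤ Sx k := fun k => (spread_nonneg _).trans (hSx k)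
  have hSy0 : ∀ k, 0 ≤ Sy k := fun k => (spread_nonneg _).trans (hSy k)
  have hadm' : ∀ k, (step P ft (A k) (γ k) (s k)).Admissible P := fun k => hs k ▸ hadm (k + 1)
  have hδx : ∀ k i, ‖(step P ft (A k) (γ k) (s k)).x i - (s k).x i‖ ≤ Sx k + γ k * d k :=
    fun k i => by
      rw [step_x]
      exact (norm_mix_half_sub_le (hW k) (hγ k).1 i).trans (add_le_add_left (hSx k) _)
  have hδx0 : ∀ k, 0 ≤ Sx k + γ k * d k := fun k =>
    add_nonneg (hSx0 k) (mul_nonneg (hγ k).1 (hd0 k))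
  have hinn : ∀ k, ‖innovation P ft (A k) (γ k) (s k)‖ ≤ Ls / φ₀ * (Sx k + γ k * d k) := fun k =>
    (hadm k).norm_innovation_le (hadm' k) hP hφ₀ (hφstep k ▸ hφ (k + 1)) (hδx0 k) (hδx k)
  have hδy : ∀ k i, ‖(step P ft (A k) (γ k) (s k)).y i - (s k).y i‖ ≤
      Sy k + Ls / φ₀ * (Sx k + γ k * d k) := fun k i => by
    have e : (step P ft (A k) (γ k) (s k)).y i - (s k).y i =
        -((s k).y i - ∑ j, W k i j • (s k).y j) + innovation P ft (A k) (γ k) (s k) i := by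
      rw [step_y, Pi.add_apply]
      simp only [mix, hWd]
      abel
    rw [e]
    refine (norm_add_le _ _).trans (add_le_add ?_ ((norm_le_pi_norm _ i).trans (hinn k)))
    rw [norm_neg]
    exact (norm_sub_sum_smul_le_spread ((hW k).nonneg i) ((hW k).sum_eq i) _ i).trans (hSy k)
  obtain ⟨b₀, hb₀⟩ := hP.bddBelow
  have main := key (fun k => energy P (s k)) d Sx Sy γ b₀
    (fun k => (hb₀ ⟨_, (hadm k).wavg_mem hP hI, rfl⟩).trans ((hadm k).le_energy hP hI))
    hd0 hSx0 hSy0 hγ hγbar hγsum (fun k => ?_) (fun k => ?_) (fun k => ?_) (fun k => ?_)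
  · exact ⟨main.1, squeeze_zero (fun k => spread_nonneg _) hSx main.2.1,
      squeeze_zero (fun k => spread_nonneg _) hSy main.2.2⟩
  · have h := (hadm k).energy_step_le hP hS hI hτ hκ (hAnn k) (hA k).diag (hc k) (hγ k).1 (hγ k).2
      hφ₀.le (hφ k) hτ₀.le hi₀
    rw [← hs] at h
    refine h.trans (add_le_add_left (add_le_add_right (mul_le_mul_of_nonneg_left
      (add_le_add (hSx k) (hSy k)) ?_) _) _)
    exact mul_nonneg (mul_nonneg (by positivity) (hγ k).1) (norm_nonneg _)
  · refine (hSxrec k).trans (add_le_add_right (mul_le_mul_of_nonneg_left ?_ hC0) _)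
    rw [norm_smul, Real.norm_of_nonneg (hγ k).1]
    exact mul_le_mul_of_nonneg_left ((hW k).norm_mix_le _) (hγ k).1
  · refine (hSyrec k).trans (add_le_add_right ?_ _)
    rw [mul_assoc C (Ls / φ₀)]
    exact mul_le_mul_of_nonneg_left (hinn k) hC0
  · have h := (hadm k).norm_dir_step_le (hadm' k) hP hS hτ hτ₀ hi₀ (hδx0 k)
      (add_nonneg (hSy0 k) (mul_nonneg (by positivity) (hδx0 k))) (hδx k) (hδy k)
    rw [← hs] at h
    refine h.trans (add_le_add_right ?_ _)
    set T := Sx k + Sy k + γ k * d k with hTd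
    have h1 : Sx k + γ k * d k ≤ T := by linarith [hSy0 k]
    have h2 : Sy k + Ls / φ₀ * (Sx k + γ k * d k) ≤ (1 + Ls / φ₀) * T := by
      have := mul_le_mul_of_nonneg_left h1 (by positivity : 0 ≤ Ls / φ₀)
      have : Sy k ≤ T := by linarith [hδx0 k]
      linarith
    calc _ ≤ τ₀⁻¹ * ((Lts + Ls) * T + I * ((1 + Ls / φ₀) * T)) + T := by
          gcongr
      _ = _ := by ring

theorem run_admissible (hI : 0 < I) {κ : ℝ} (hκ : 0 < κ) {τ : Fin I → ℝ} (hτ : ∀ i, 0 < τ i)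
    {L Lt : Fin I → ℝ≥0} {P : Problem I m} {ft : Fin I → Vec m → Vec m → ℝ}
    {Γ : ℕ → Digraph (Fin I)} {A : ℕ → Matrix (Fin I) (Fin I) ℝ} {γ : ℕ → ℝ}
    {x₀ : Fin I → Vec m} (hP : P.Regular L) (hS : IsSurrogate P ft τ Lt)
    (hA : ∀ k, Compliant κ (Γ k) (A k)) (hc : ∀ k, ColumnStochastic (A k))
    (hx₀ : ∀ i, x₀ i ∈ P.X) (hγ : ∀ k, 0 ≤ γ k ∧ γ k ≤ 1) (k : ℕ) :
    (run P ft A γ x₀ k).Admissible P := by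
  induction k with
  | zero =>
    refine ⟨hx₀, fun _ => zero_lt_one, by simp [run], ?_⟩
    rw [Finset.smul_sum]
    rfl
  | succ k ih =>
    exact ih.step hP hS hI hτ hκ ((hA k).nonneg hκ) (hA k).diag (hc k) (hγ k).1 (hγ k).2

theorem tendsto_merit (hI : 0 < I) {τ : Fin I → ℝ} (hτ : ∀ i, 0 < τ i)
    {L Lt : Fin I → ℝ≥0} {P : Problem I m} {ft : Fin I → Vec m → Vec m → ℝ} (hP : P.Regular L)
    (hS : IsSurrogate P ft τ Lt) {s : ℕ → State I m} (hadm : ∀ k, (s k).Admissible P)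
    (hd : Tendsto (fun k => ‖dir P ft (s k)‖) atTop (𝓝 0))
    (hx : Tendsto (fun k => spread (s k).x) atTop (𝓝 0))
    (hy : Tendsto (fun k => spread (s k).y) atTop (𝓝 0)) :
    Tendsto (fun k => P.J (avg (s k).x)) atTop (𝓝 0) ∧
      Tendsto (fun k => merit P (s k).x) atTop (𝓝 0) := by
  have hJ : Tendsto (fun k => P.J (avg (s k).x)) atTop (𝓝 0) := by
    let i : Fin I := ⟨0, hI⟩
    refine squeeze_zero (fun k => norm_nonneg _) (g := fun k => 2 * spread (s k).x +
      (2 + Lt i + L i) * ‖dir P ft (s k)‖ + (I * spread (s k).y +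
        (∑ i, (L i : ℝ)) * spread (s k).x)) (fun k => ?_) ?_
    · refine (hS.J_le hP (hτ i) ((hadm k).mem i)).trans (add_le_add (add_le_add ?_ ?_) ?_)
      · exact mul_le_mul_of_nonneg_left (norm_sub_avg_le hI _ i) zero_le_two
      · exact mul_le_mul_of_nonneg_left (norm_le_pi_norm (dir P ft (s k)) i) (by positivity)
      · exact (hadm k).tracking_error_le hP hI ((hadm k).avg_mem hP hI) (norm_sub_avg_le hI _) i
    · simpa using ((hx.const_mul 2).add (hd.const_mul (2 + (Lt i : ℝ) + L i))).add
        ((hy.const_mul (I : ℝ)).add (hx.const_mul (∑ i, (L i : ℝ))))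
  have hD : Tendsto (fun k => disagreement (s k).x ^ 2) atTop (𝓝 0) :=
    squeeze_zero (fun k => sq_nonneg _) (fun k => disagreement_sq_le hI (s k).x)
      (by simpa using (hx.pow 2).const_mul (I : ℝ))
  exact ⟨hJ, by simpa [merit] using (hJ.pow 2).max hD⟩

end Sonata

theorem mainTheorem1 (I B : ℕ) (hI : 0 < I) (hB : 0 < B) (κ : ℝ) (hκ : 0 < κ)
    (τ : Fin I → ℝ) (hτ : ∀ i, 0 < τ i) (L Lt : Fin I → ℝ≥0) :
    ∃ γbar : ℝ, 0 < γbar ∧ γbar ≤ 1 ∧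
      ∀ (m : ℕ) (P : Sonata.Problem I m) (ft : Fin I → Sonata.Vec m → Sonata.Vec m → ℝ)
        (Γ : ℕ → Digraph (Fin I)) (A : ℕ → Matrix (Fin I) (Fin I) ℝ) (γ : ℕ → ℝ)
        (x₀ : Fin I → Sonata.Vec m) (s : ℕ → Sonata.State I m),
        P.Regular L →
        Sonata.IsSurrogate P ft τ Lt →
        Sonata.BStronglyConnected B Γ →
        (∀ k, Sonata.Compliant κ (Γ k) (A k)) →
        (∀ k, Sonata.ColumnStochastic (A k)) →
        (∀ i, x₀ i ∈ P.X) →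
        (∀ k, 0 < γ k ∧ γ k ≤ 1) →
        (Sonata.Diminishing γ ∨ ∃ c ≤ γbar, ∀ k, γ k = c) →
        s = Sonata.run P ft A γ x₀ →
        (∀ k i, ∃! z, z ∈ Sonata.minimizers P.X (Sonata.localModel P ft (s k) i)) ∧
        (∀ k, ∃! z, z ∈ Sonata.minimizers P.X (P.proxModel (Sonata.avg (s k).x))) ∧
        Tendsto (fun k => Sonata.merit P (s k).x) atTop (𝓝 0) ∧
        (∀ i, Tendsto (fun k => ‖(s k).x i - Sonata.avg (s k).x‖) atTop (𝓝 0)) ∧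
        (∀ z, MapClusterPt z atTop (fun k => Sonata.avg (s k).x) → P.IsDStationary z) := by
  by_cases hκ1 : κ ≤ 1
  · obtain ⟨γbar, h0, h1, key⟩ := Sonata.exists_stepsize_tendsto hI hB hκ hκ1 hτ L Lt
    refine ⟨γbar, h0, h1, ?_⟩
    intro m P ft Γ A γ x₀ s hP hS hΓ hA hc hx₀ hγ hrule hs
    subst hs
    have hγ' : ∀ k, 0 ≤ γ k ∧ γ k ≤ 1 := fun k => ⟨(hγ k).1.le, (hγ k).2⟩
    have hadm := Sonata.run_admissible hI hκ hτ hP hS hA hc hx₀ hγ'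
    have hstep : (∀ᶠ k in atTop, γ k ≤ γbar) ∧
        Tendsto (fun n => ∑ k ∈ Finset.range n, γ k) atTop atTop := by
      rcases hrule with ⟨hlim, hsum⟩ | ⟨c, hcle, hconst⟩
      · exact ⟨hlim.eventually_le_const h0, hsum⟩
      · refine ⟨Eventually.of_forall fun k => (hconst k).trans_le hcle, ?_⟩
        simp only [hconst, Finset.sum_const, Finset.card_range, nsmul_eq_mul]
        exact tendsto_natCast_atTop_atTop.atTop_mul_const (hconst 0 ▸ (hγ 0).1)
    obtain ⟨hd, hx, hy⟩ := key m P ft Γ A γ _ hP hS hΓ hA hc hγ' hstep.1 hstep.2 hadm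
      (fun _ => rfl) fun _ => rfl
    obtain ⟨hJ, hM⟩ := Sonata.tendsto_merit hI hτ hP hS hadm hd hx hy
    exact ⟨fun k i => hS.existsUnique_localModel hP (hτ i) ((hadm k).mem i),
      fun k => hP.existsUnique_proxModel _, hM,
      fun i => squeeze_zero (fun k => norm_nonneg _) (fun k => Sonata.norm_sub_avg_le hI _ i) hx,
      fun z hz => hP.isDStationary_of_mapClusterPt (fun k => (hadm k).avg_mem hP hI) hJ hz⟩
  -- For κ > 1 no column-stochastic matrix is compliant, so any threshold works.
  · refine ⟨1, one_pos, le_rfl, ?_⟩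
    intro m P ft Γ A γ x₀ s _ _ _ hA hc
    exact absurd ((hA 0).kappa_le_one hI hκ (hc 0)) hκ1
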